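/- **Theorem.** Let $n\ge 1$, let $K$ be a field and let $\nu:K\to\mathbb Z\cup\{+\infty\}$ be a discrete valuation for which there is a uniformizer $\pi\in K$, $\nu(\pi)=1$; let $\mathcal O=\{x\in K:\nu(x)\ge 0\}$. Let $X$ be the affine Bruhat–Tits building of $SL(n,K)$, i.e. the geometric realization of the simplicial complex whose vertices are the homothety classes (modulo $K^\times$) of $\mathcal O$-lattices in $K^n$ (finitely generated $\mathcal O$-submodules spanning $K^n$) and in which $m+1$ distinct vertices form an $m$-simplex if they have representatives with $L_0\subset L_1\subset\dots\subset L_m\subset\pi^{-1}L_0$. Equip $X$ with its canonical piecewise Euclidean length metric: the simplex of the chain $L_0\subset\dots\subset L_m\subset \pi^{-1}L_0$ carries the Euclidean metric for which $[L_i]\mapsto \omega_{k_i}$, $k_i=\operatorname{length}_{\mathcal O}(L_i/L_0)$, extends to an affine isometry, where $\omega_k=e_1+\dots+e_k-\frac kn(e_1+\dots+e_n)\in\mathbb R^n$, and the distance of two points is the infimum of the lengths of the broken lines joining them, each of whose steps lies in one closed simplex. Then $X$ has finite asymptotic dimension; more precisely, $\operatorname{asdim}X=n-1$. Here $\operatorname{asdim}X\le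 k$ means that for every $d>0$ there is a uniformly bounded cover of $X$ such that every ball of radius $d$ in $X$ meets at most $k+1$ elements of the cover, and $\operatorname{asdim}X$ is the least such $k$. -/

import Mathlib

open scoped Pointwise ENNReal NNReal

noncomputable section

/-! ## Asymptotic dimension -/

/-- `X` has asymptotic dimension at most `k`: for every `d > 0` there is a uniformly bounded cover
`U` of `X` such that every ball of radius `d` meets at most `k + 1` elements of `U`. -/
def AsdimLE (X : Type*) [PseudoEMetricSpace X] (k : ℕ) : Prop :=
  ∀ d : ℝ≥0, 0 < d → ∃ U : Set (Set X),
    ⋃₀ U = Set.univ ∧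
    (∃ R : ℝ≥0, ∀ A ∈ U, ∀ x ∈ A, ∀ y ∈ A, edist x y ≤ R) ∧
    ∀ x : X, {A ∈ U | ∃ y ∈ A, edist y x < d}.encard ≤ k + 1

/-- The asymptotic dimension: the least `k` with `AsdimLE X k`, and `⊤` if there is none. -/
def asdim (X : Type*) [PseudoEMetricSpace X] : ℕ∞ :=
  ⨅ (k : ℕ) (_ : AsdimLE X k), (k : ℕ∞)

namespace BruhatTits

/-! ## Lattices in `K ^ n` and their homothety classes -/

/-- The ring of integers `𝒪 = {x | 0 ≤ ν x}` of a discrete valuation. -/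
def ringOfIntegers {K : Type*} [Field K] (ν : AddValuation K (WithTop ℤ)) : ValuationSubring K where
  carrier := {x | 0 ≤ ν x}
  mul_mem' {a b} ha hb := by
    simp only [Set.mem_ofPred_eq] at ha hb ⊢
    rw [ν.map_mul]
    exact add_nonneg ha hb
  one_mem' := by simp
  add_mem' {a b} ha hb := ν.map_le_add ha hb
  zero_mem' := by simp
  neg_mem' {a} ha := by
    simpa only [Set.mem_ofPred_eq, AddValuation.map_neg] using ha
  mem_or_inv_mem' x := by
    simp only [Set.mem_ofPred_eq]
    by_contra! h
    rcases eq_or_ne x 0 with rfl | hx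
    · simp at h
    · have h1 : ν x + ν x⁻¹ = 0 := by rw [← ν.map_mul, mul_inv_cancel₀ hx, ν.map_one]
      have h2 : ν x ≠ ⊤ := ν.ne_top_iff.2 hx
      have h3 : ν x⁻¹ ≠ ⊤ := ν.ne_top_iff.2 (inv_ne_zero hx)
      generalize ν x = a at *
      generalize ν x⁻¹ = b at *
      lift a to ℤ using h2
      lift b to ℤ using h3
      norm_cast at h h1
      lia

/-- The `𝒪`-lattices in `K ^ n`: finitely generated `𝒪`-submodules that span `K ^ n` over `K`. -/
abbrev Lattice {K : Type*} [Field K] (ν : AddValuation K (WithTop ℤ)) (n : ℕ) : Type _ :=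
  {L : Submodule (ringOfIntegers ν) (Fin n → K) // Submodule.IsLattice K L}

/-- Two lattices are homothetic if one is the multiple of the other by an element of `K ^ ×`. -/
def homothety {K : Type*} [Field K] (ν : AddValuation K (WithTop ℤ)) (n : ℕ) :
    Setoid (Lattice ν n) where
  r L M := ∃ a : Kˣ, M.1 = a • L.1
  iseqv :=
    { refl := fun L => ⟨1, by simp⟩
      symm := by
        rintro L M ⟨a, h⟩
        exact ⟨a⁻¹, by rw [h, inv_smul_smul]⟩
      trans := by
        rintro L M N ⟨a, h⟩ ⟨b, h'⟩
        exact ⟨b * a, by rw [h', h, mul_smul]⟩ }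

/-- The vertices of the building: homothety classes of lattices. -/
abbrev Vertex {K : Type*} [Field K] (ν : AddValuation K (WithTop ℤ)) (n : ℕ) : Type _ :=
  Quotient (homothety ν n)

/-- The homothety class of a lattice. -/
abbrev Lattice.cls {K : Type*} [Field K] {ν : AddValuation K (WithTop ℤ)} {n : ℕ}
    (L : Lattice ν n) : Vertex ν n :=
  Quotient.mk (homothety ν n) L

/-! ## The simplicial complex -/

/-- Chains `L₀ ⊂ L₁ ⊂ ⋯ ⊂ Lₘ ⊂ π⁻¹ L₀` of lattices, all inclusions being strict. (The homothety
classes of the members of such a chain are then automatically distinct.) -/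
def IsLatticeChain {K : Type*} [Field K] {ν : AddValuation K (WithTop ℤ)} (π : K) {n m : ℕ}
    (L : Fin (m + 1) → Lattice ν n) : Prop :=
  StrictMono L ∧ (L (Fin.last m)).1 < π⁻¹ • (L 0).1

/-- The members of a lattice chain are pairwise non-homothetic. -/
theorem IsLatticeChain.cls_injective {K : Type*} [Field K] {ν : AddValuation K (WithTop ℤ)}
    {π : K} (hπ : ν π = 1) {n m : ℕ} {L : Fin (m + 1) → Lattice ν n}
    (hL : IsLatticeChain π L) : Function.Injective fun i => (L i).cls := by
  suffices H : ∀ i j, i < j → (L i).cls ≠ (L j).cls by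
    intro i j hij
    rcases lt_trichotomy i j with h | h | h
    · exact (H i j h hij).elim
    · exact h
    · exact (H j i h hij.symm).elim
  intro i j hij h
  obtain ⟨a, ha⟩ : ∃ a : Kˣ, (L j).1 = a • (L i).1 := Quotient.exact h
  have hlt : (L i).1 < (L j).1 := hL.1 hij
  have hlt' : (L j).1 < π⁻¹ • (L i).1 := by
    refine lt_of_le_of_lt (hL.1.monotone (Fin.le_last j)) (lt_of_lt_of_le hL.2 ?_)
    exact Submodule.map_mono (hL.1.monotone (Fin.zero_le i))
  have hπ0 : π ≠ 0 := by
    rintro rfl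
    simp at hπ
  -- scaling by an element of non-negative valuation shrinks a lattice
  have key : ∀ c : K, 0 ≤ ν c → ∀ M : Submodule (ringOfIntegers ν) (Fin n → K), c • M ≤ M := by
    rintro c hc M x ⟨y, hy, rfl⟩
    exact M.smul_mem (⟨c, hc⟩ : ringOfIntegers ν) hy
  have ha' : (L j).1 = (a : K) • (L i).1 := ha
  have hva : ν (a : K) ≠ ⊤ := ν.ne_top_iff.2 a.ne_zero
  rcases le_or_gt 0 (ν (a : K)) with h0 | h0
  · exact absurd (key a h0 (L i).1) (by rw [← ha']; exact not_le_of_gt hlt)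
  · have h1 : 0 ≤ ν ((a : K)⁻¹ * π⁻¹) := by
      have e : ν ((a : K)⁻¹ * π⁻¹) + (ν (a : K) + ν π) = 0 := by
        rw [← ν.map_mul, ← ν.map_mul, ← mul_inv, inv_mul_cancel₀ (by simp [hπ0]), ν.map_one]
      have hne : ν ((a : K)⁻¹ * π⁻¹) ≠ ⊤ := ν.ne_top_iff.2 (by simp [hπ0])
      rw [hπ] at e
      generalize ν (a : K) = s at *
      generalize ν ((a : K)⁻¹ * π⁻¹) = t at *
      lift s to ℤ using hva
      lift t to ℤ using hne
      norm_cast at *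
      lia
    have h2 := Submodule.map_mono (f := DistribSMul.toLinearMap (ringOfIntegers ν) (Fin n → K) (a : K))
      (key _ h1 (L i).1)
    change (a : K) • (((a : K)⁻¹ * π⁻¹) • (L i).1) ≤ (a : K) • (L i).1 at h2
    rw [smul_smul, ← mul_assoc, mul_inv_cancel₀ a.ne_zero, one_mul, ← ha'] at h2
    exact not_le_of_gt hlt' h2

/-- The Bruhat–Tits building as a simplicial complex: the `m`-simplices are the sets of
`m + 1` vertices with representatives `L₀ ⊂ L₁ ⊂ ⋯ ⊂ Lₘ ⊂ π⁻¹ L₀`. -/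
def complex {K : Type*} [Field K] (ν : AddValuation K (WithTop ℤ)) (π : K) (n : ℕ) :
    PreAbstractSimplicialComplex (Vertex ν n) where
  faces := {s | ∃ (m : ℕ) (L : Fin (m + 1) → Lattice ν n), IsLatticeChain π L ∧
    (s : Set (Vertex ν n)) = Set.range fun i => (L i).cls}
  isRelLowerSet_faces := by
    classical
    rintro s ⟨m, L, hL, hs⟩
    refine ⟨?_, ?_⟩
    · rw [← Finset.coe_nonempty, hs]
      exact Set.range_nonempty _
    · intro t hts ht
      let I : Finset (Fin (m + 1)) := Finset.univ.filter fun i => (L i).cls ∈ t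
      have hI : I.Nonempty := by
        obtain ⟨v, hv⟩ := ht
        have : v ∈ (s : Set (Vertex ν n)) := hts hv
        rw [hs] at this
        obtain ⟨i, rfl⟩ := this
        exact ⟨i, by simpa [I] using hv⟩
      obtain ⟨k, hk⟩ : ∃ k, I.card = k + 1 :=
        ⟨I.card - 1, by have := hI.card_pos; lia⟩
      let e := I.orderEmbOfFin hk
      refine ⟨k, fun i => L (e i), ⟨hL.1.comp e.strictMono, ?_⟩, ?_⟩
      · refine lt_of_le_of_lt (hL.1.monotone (Fin.le_last _)) (lt_of_lt_of_le hL.2 ?_)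
        exact Submodule.map_mono (hL.1.monotone (Fin.zero_le _))
      · ext v
        simp only [Finset.mem_coe, Set.mem_range]
        constructor
        · intro hv
          have : v ∈ (s : Set (Vertex ν n)) := hts hv
          rw [hs] at this
          obtain ⟨i, rfl⟩ := this
          have hi : i ∈ Set.range e := by
            rw [Finset.range_orderEmbOfFin]
            simpa [I] using hv
          obtain ⟨j, rfl⟩ := hi
          exact ⟨j, rfl⟩
        · rintro ⟨j, rfl⟩
          exact (Finset.mem_filter.1 (Finset.orderEmbOfFin_mem I hk j)).2

/-! ## The geometric realization and its metric -/

/-- The affine Bruhat–Tits building of `SL(n, K)`: the geometric realization of the simplicial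
complex above. A point is given by its barycentric coordinates, i.e. by non-negative real weights
on the vertices, of total weight `1` and supported on a simplex. -/
structure AffineBuilding {K : Type*} [Field K] (ν : AddValuation K (WithTop ℤ)) (π : K)
    (n : ℕ) where
  /-- the barycentric coordinates of the point -/
  coord : Vertex ν n →₀ ℝ
  coord_nonneg : ∀ v, 0 ≤ coord v
  sum_coord : coord.sum (fun _ t => t) = 1
  support_mem : coord.support ∈ complex ν π n

/-- The vertices `ω_k = e_1 + ⋯ + e_k - (k / n) (e_1 + ⋯ + e_n)`, `0 ≤ k < n`, of the standard
Euclidean alcove of type `Ã_{n-1}` in the hyperplane `∑ x_j = 0` of `ℝ ^ n`. -/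
def alcoveVertex (n k : ℕ) : EuclideanSpace ℝ (Fin n) :=
  WithLp.toLp 2 fun j => (if (j : ℕ) < k then 1 else 0) - (k : ℝ) / n

/-- The length of `M / L` as an `𝒪`-module (its dimension over the residue field if
`L ⊆ M ⊆ π⁻¹ L`). -/
def relLength {K : Type*} [Field K] {ν : AddValuation K (WithTop ℤ)} {n : ℕ}
    (L M : Lattice ν n) : ℕ :=
  (Module.length (ringOfIntegers ν) (M.1 ⧸ L.1.submoduleOf M.1)).toNat

namespace AffineBuilding

variable {K : Type*} [Field K] {ν : AddValuation K (WithTop ℤ)} {π : K} {n : ℕ}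

/-- The point lies in the closed simplex spanned by the chain `L`. -/
def LiesIn {m : ℕ} (x : AffineBuilding ν π n) (L : Fin (m + 1) → Lattice ν n) : Prop :=
  ∀ v, x.coord v ≠ 0 → ∃ i, (L i).cls = v

/-- The affine chart of the closed simplex spanned by a chain `L`: it sends the vertex `[L i]` to
the vertex `ω_k` of the standard alcove, where `k` is the length of `L i / L 0`. -/
def chart {m : ℕ} (L : Fin (m + 1) → Lattice ν n) (x : AffineBuilding ν π n) :
    EuclideanSpace ℝ (Fin n) :=
  ∑ i, x.coord (L i).cls • alcoveVertex n (relLength (L 0) (L i))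

/-- The Euclidean distance of two points that lie in a common closed simplex, measured in the
chart of that simplex (all charts of simplices containing both points give the same value);
`∞` if there is no such simplex. -/
def simplexDist (x y : AffineBuilding ν π n) : ℝ≥0∞ :=
  ⨅ (m : ℕ) (L : Fin (m + 1) → Lattice ν n)
    (_ : IsLatticeChain π L ∧ x.LiesIn L ∧ y.LiesIn L), edist (chart L x) (chart L y)

theorem simplexDist_comm (x y : AffineBuilding ν π n) : simplexDist x y = simplexDist y x := by
  unfold simplexDist
  refine iInf_congr fun m => iInf_congr fun L => iInf_congr_Prop (by tauto) fun _ => ?_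
  exact edist_comm _ _

/-- The length of the broken line `p 0, p 1, …, p k`. -/
def pathLength (k : ℕ) (p : ℕ → AffineBuilding ν π n) : ℝ≥0∞ :=
  ∑ i ∈ Finset.range k, simplexDist (p i) (p (i + 1))

/-- The canonical piecewise Euclidean length metric of the building: the infimum of the lengths
of the broken lines from `x` to `y` each of whose steps stays in one closed simplex. -/
instance : PseudoEMetricSpace (AffineBuilding ν π n) where
  edist x y := ⨅ (k : ℕ) (p : ℕ → AffineBuilding ν π n) (_ : p 0 = x ∧ p k = y), pathLength k p
  edist_self x := by
    refine le_antisymm ?_ zero_le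
    exact iInf_le_of_le 0 (iInf_le_of_le (fun _ => x) (iInf_le_of_le ⟨rfl, rfl⟩ (by
      simp [pathLength])))
  edist_comm := by
    suffices H : ∀ x y : AffineBuilding ν π n,
        (⨅ (k : ℕ) (p : ℕ → AffineBuilding ν π n) (_ : p 0 = x ∧ p k = y), pathLength k p) ≤
        ⨅ (k : ℕ) (p : ℕ → AffineBuilding ν π n) (_ : p 0 = y ∧ p k = x), pathLength k p from
      fun x y => le_antisymm (H x y) (H y x)
    intro x y
    refine le_iInf fun k => le_iInf fun p => le_iInf fun h => ?_
    refine iInf_le_of_le k (iInf_le_of_le (fun i => p (k - i))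
      (iInf_le_of_le ⟨by simpa using h.2, by simpa using h.1⟩ (le_of_eq ?_)))
    unfold pathLength
    rw [← Finset.sum_range_reflect]
    refine Finset.sum_congr rfl fun i hi => ?_
    have hi' : i < k := Finset.mem_range.1 hi
    rw [simplexDist_comm]
    have e1 : k - (k - 1 - i) = i + 1 := by lia
    have e2 : k - (k - 1 - i + 1) = i := by lia
    simp only [e1, e2]
  edist_triangle x y z := by
    simp only [ENNReal.iInf_add, ENNReal.add_iInf]
    refine le_iInf fun l => le_iInf fun q => le_iInf fun hq => le_iInf fun k => le_iInf fun p =>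
      le_iInf fun hp => ?_
    refine iInf_le_of_le (k + l) (iInf_le_of_le (fun i => if i < k then p i else q (i - k))
      (iInf_le_of_le ⟨?_, by simpa using hq.2⟩ ?_))
    · rcases Nat.eq_zero_or_pos k with rfl | hk
      · simpa [← hp.1, hp.2] using hq.1
      · simpa [hk] using hp.1
    · unfold pathLength
      rw [Finset.sum_range_add]
      refine le_of_eq ?_
      congr 1
      · refine Finset.sum_congr rfl fun i hi => ?_
        have hi' : i < k := Finset.mem_range.1 hi
        simp only [if_pos hi']
        by_cases h : i + 1 < k
        · simp only [if_pos h]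
        · have : i + 1 = k := by lia
          simp [this, hp.2, hq.1]
      · refine Finset.sum_congr rfl fun i _ => ?_
        have e1 : ¬ k + i < k := by lia
        have e2 : ¬ k + i + 1 < k := by lia
        have e3 : k + i - k = i := by lia
        have e4 : k + i + 1 - k = i + 1 := by lia
        simp only [if_neg e1, if_neg e2, e3, e4]

end AffineBuilding

end BruhatTits

end

/-! Up to bounded error, distances in the building are measured by comparing lattices. The order of
a nonzero vector `w` with respect to a lattice, minus the order of a fixed vector, depends only on
the homothety class and changes by at most 1 within a simplex. Its affine extension `realOrd` is
Lipschitz with constant `2 * n` (`edist_realOrd_le`). Conversely, if `π ^ k L ⊆ M` and `π ^ k M ⊆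
L`, then `[L]` and `[M]` are joined by at most `2 * k` steps inside simplices
(`edist_vertexPoint_le`).

Lower bound. Diagonal lattices with first exponent 0 form a coarse copy of `ℤ ^ (n - 1)`, whose
coordinates are recovered from normalized orders of basis vectors. By Kuhn's cubical Sperner lemma,
any uniformly bounded cover has, near some unit cube of this copy, `n` different members
(`le_of_asdimLE`).

Upper bound. The model is a tree cut into horospherical bands as seen from an end, two points of a
band being put together if they have the same ancestor far above the band. Here the end is replaced
by the standard flag and the horofunction by the exponents `lead` of the successive intersections of
the lattice with the flag. With the exponent of index 0 normalized to 0, they give a coarsely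
Lipschitz map to `ℤ ^ (n - 1)`. Periodic boxes separated by gaps, in `n` shifted copies, cover `ℤ ^
(n - 1)` (`exists_color`). The preimage of a box is unbounded; it is split according to `hull`,
which plays the ancestor. For exponents increasing fast enough, nearby lattices have the same hull
(`hull_le`), while a common hull forces lattices over one box to be boundedly close
(`scale_le_of_hull_eq`). So a ball of radius `d` meets at most one piece of each of the `n` colors.
-/

noncomputable section

/-! ## A cubical Sperner lemma -/

namespace Sperner

variable {m : ℕ}

/-- The number modulo 2 of chains `x = v₀, v₁, …, vₖ` with `vⱼ₊₁ = vⱼ + e_{i_j}` for distinct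
directions `i_j ∈ S` such that the labels `ℓ v₀, …, ℓ vₖ` are distinct and make up `Λ`. -/
def count (ℓ : (Fin m → ℤ) → ℕ) :
    ℕ → Finset (Fin m) → Finset ℕ → (Fin m → ℤ) → ZMod 2
  | 0, _, Λ, x => if Λ = {ℓ x} then 1 else 0
  | k + 1, S, Λ, x => if ℓ x ∈ Λ then
      ∑ i ∈ S, count ℓ k (S.erase i) (Λ.erase (ℓ x)) (x + Pi.single i 1) else 0

variable (ℓ : (Fin m → ℤ) → ℕ)

/-- The bridge from parity to points: it extracts the final cube, and it shows that counts vanish on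
faces where a required label cannot occur. -/
theorem exists_of_count_ne_zero (k : ℕ) : ∀ (S : Finset (Fin m)) (Λ : Finset ℕ)
    (x : Fin m → ℤ), count ℓ k S Λ x ≠ 0 → ∀ a ∈ Λ, ∃ y : Fin m → ℤ,
      (∀ i ∈ S, x i ≤ y i ∧ y i ≤ x i + 1) ∧ (∀ i ∉ S, y i = x i) ∧ ℓ y = a := by
  induction k with
  | zero =>
    intro S Λ x h a ha
    have hΛ : Λ = {ℓ x} := by
      by_contra hne
      exact h (by simp [count, hne])
    rw [hΛ, Finset.mem_singleton] at ha
    exact ⟨x, by simp, by simp, ha.symm⟩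
  | succ k ih =>
    intro S Λ x h a ha
    rw [count] at h
    split_ifs at h with hx
    · rcases eq_or_ne a (ℓ x) with rfl | hne
      · exact ⟨x, by simp, by simp, rfl⟩
      · obtain ⟨i, hi, hne'⟩ := Finset.exists_ne_zero_of_sum_ne_zero h
        obtain ⟨y, h1, h2, h3⟩ := ih _ _ _ hne' a (Finset.mem_erase.2 ⟨hne, ha⟩)
        refine ⟨y, fun j hj => ?_, fun j hj => ?_, h3⟩
        · rcases eq_or_ne j i with rfl | hji
          · have := h2 j (Finset.notMem_erase _ _)
            simp at this
            lia
          · have := h1 j (Finset.mem_erase.2 ⟨hji, hj⟩)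
            simpa [hji] using this
        · have hji : j ≠ i := fun e => hj (e ▸ hi)
          have := h2 j (fun e => hj (Finset.mem_of_mem_erase e))
          simpa [hji] using this
    · exact absurd rfl h

theorem sum_sum_erase_eq_zero {α : Type*} [DecidableEq α] (S : Finset α)
    (f : α → α → ZMod 2) (hf : ∀ i j, f i j = f j i) :
    ∑ i ∈ S, ∑ j ∈ S.erase i, f i j = 0 := by
  rw [Finset.sum_sigma']
  refine Finset.sum_involution (fun p _ => ⟨p.2, p.1⟩) ?_ ?_ ?_ ?_
  · rintro ⟨i, j⟩ h
    simp only
    rw [hf j i]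
    exact CharTwo.add_self_eq_zero _
  · rintro ⟨i, j⟩ h - e
    simp only [Finset.mem_sigma, Finset.mem_erase] at h
    simp only [Sigma.mk.injEq] at e
    exact h.2.1 e.1
  · rintro ⟨i, j⟩ h
    simp only [Finset.mem_sigma, Finset.mem_erase] at h ⊢
    exact ⟨h.2.2, h.2.1.symm, h.1⟩
  · rintro ⟨i, j⟩ h
    rfl

/-- Split off the first vertex. If its label is not in `Λ`, only `a = ℓ x` contributes. If it is,
the inner sum on the right has the extra term `a = ℓ x`, which equals the first summand and cancels
it modulo 2. -/
theorem count_succ_insert {N : ℕ} (hN : ∀ x, ℓ x < N) (k : ℕ) (S : Finset (Fin m))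
    (Λ : Finset ℕ) (x : Fin m → ℤ) :
    ∑ a ∈ (Finset.range N).filter (· ∉ Λ), count ℓ (k + 1) S (insert a Λ) x =
      ∑ i ∈ S, (count ℓ k (S.erase i) Λ (x + Pi.single i 1) +
        if ℓ x ∈ Λ then ∑ a ∈ (Finset.range N).filter (· ∉ Λ.erase (ℓ x)),
          count ℓ k (S.erase i) (insert a (Λ.erase (ℓ x))) (x + Pi.single i 1) else 0) := by
  by_cases hx : ℓ x ∈ Λ
  · have hfil : (Finset.range N).filter (· ∉ Λ.erase (ℓ x)) =
        insert (ℓ x) ((Finset.range N).filter (· ∉ Λ)) := by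
      ext a
      simp only [Finset.mem_filter, Finset.mem_range, Finset.mem_erase, Finset.mem_insert]
      have := hN x
      by_cases h : a = ℓ x
      · simp [h, this]
      · simp [h]
    have h1 : ∀ a ∈ (Finset.range N).filter (· ∉ Λ), count ℓ (k + 1) S (insert a Λ) x =
        ∑ i ∈ S, count ℓ k (S.erase i) (insert a (Λ.erase (ℓ x))) (x + Pi.single i 1) := by
      intro a ha
      have hne : a ≠ ℓ x := by
        rintro rfl
        exact (Finset.mem_filter.1 ha).2 hx
      rw [count, if_pos (Finset.mem_insert_of_mem hx), Finset.erase_insert_of_ne hne]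
    rw [Finset.sum_congr rfl h1, Finset.sum_comm]
    refine Finset.sum_congr rfl fun i _ => ?_
    rw [if_pos hx, hfil, Finset.sum_insert (by simp [hx]), Finset.insert_erase hx, ← add_assoc,
      CharTwo.add_self_eq_zero, zero_add]
  · rw [Finset.sum_eq_single (ℓ x)]
    · rw [count, if_pos (Finset.mem_insert_self _ _), Finset.erase_insert hx]
      simp [hx]
    · intro a _ ha
      rw [count, if_neg]
      simp [hx, ha.symm]
    · intro h
      simp [hx, hN x] at h

/-- A door counting identity: the chains with all labels of `Λ` and one more label, chosen among
the labels `< N`, are as many as the chains one shorter that arise at the two ends. -/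
theorem sum_count_insert {N : ℕ} (hN : ∀ x, ℓ x < N) (k : ℕ) :
    ∀ (S : Finset (Fin m)) (Λ : Finset ℕ) (x : Fin m → ℤ),
    ∑ a ∈ (Finset.range N).filter (· ∉ Λ), count ℓ (k + 1) S (insert a Λ) x =
      ∑ i ∈ S, (count ℓ k (S.erase i) Λ (x + Pi.single i 1) + count ℓ k (S.erase i) Λ x) := by
  induction k with
  | zero =>
    intro S Λ x
    rw [count_succ_insert ℓ hN]
    refine Finset.sum_congr rfl fun i _ => ?_
    congr 1
    split_ifs with hx
    · simp only [count]
      by_cases he : Λ = {ℓ x}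
      · rw [if_pos he, he, Finset.erase_singleton, Finset.sum_eq_single (ℓ (x + Pi.single i 1))]
        · simp
        · intro a _ ha
          simp [ha]
        · intro h
          simp [hN] at h
      · rw [if_neg he]
        refine Finset.sum_eq_zero fun a ha => if_neg fun h => he ?_
        have ha' := (Finset.mem_filter.1 ha).2
        have h0 : Λ.erase (ℓ x) = ∅ := by
          have := congrArg Finset.card h
          rw [Finset.card_insert_of_notMem ha', Finset.card_singleton] at this
          exact Finset.card_eq_zero.1 (by lia)
        rw [← Finset.insert_erase hx, h0]
        rfl
    · simp only [count]
      rw [if_neg]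
      rintro rfl
      simp at hx
  | succ k ih =>
    intro S Λ x
    rw [count_succ_insert ℓ hN, Finset.sum_add_distrib, Finset.sum_add_distrib]
    congr 1
    by_cases hx : ℓ x ∈ Λ
    · simp only [if_pos hx, ih]
      simp only [Finset.sum_add_distrib]
      -- These doors omit the second vertex `x + e_i`; exchanging the first two directions pairs
      -- them off.
      have hz := sum_sum_erase_eq_zero S (fun i j => count ℓ k ((S.erase i).erase j)
        (Λ.erase (ℓ x)) (x + Pi.single i 1 + Pi.single j 1)) fun i j => by
          rw [Finset.erase_right_comm, add_right_comm]
      refine (congrArg₂ (· + ·) hz rfl).trans ?_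
      rw [zero_add, Finset.sum_comm' (t' := S) (s' := fun j => S.erase j)]
      · refine Finset.sum_congr rfl fun j _ => ?_
        rw [count, if_pos hx]
        refine Finset.sum_congr rfl fun i _ => ?_
        rw [Finset.erase_right_comm]
      · intro i j
        simp only [Finset.mem_erase]
        tauto
    · simp [hx, count]

/-- The lattice points `x` with `0 ≤ x_i < N` for `i < k` and `x_i = 0` for `i ≥ k`. -/
def box (m N k : ℕ) : Finset (Fin m → ℤ) :=
  Fintype.piFinset fun i => if (i : ℕ) < k then Finset.Ico 0 (N : ℤ) else {0}

theorem mem_box {N k : ℕ} {x : Fin m → ℤ} : x ∈ box m N k ↔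
    (∀ i : Fin m, (i : ℕ) < k → 0 ≤ x i ∧ x i < N) ∧ ∀ i : Fin m, k ≤ i → x i = 0 := by
  rw [box, Fintype.mem_piFinset]
  constructor
  · refine fun h => ⟨fun i hi => ?_, fun i hi => ?_⟩
    · simpa [hi] using h i
    · simpa [hi.not_gt] using h i
  · rintro ⟨h1, h2⟩ i
    split_ifs with hi
    · simpa using h1 i hi
    · simpa using h2 i (not_lt.1 hi)

/-- Modulo 2 the sum telescopes in direction `i`, leaving the two opposite faces; the far one
contributes nothing by `hf`. -/
theorem sum_box_diff {N k : ℕ} (f : (Fin m → ℤ) → ZMod 2) (i : Fin m) (hi : (i : ℕ) < k)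
    (hf : ∀ x, x i = (N : ℤ) → f x = 0) :
    ∑ x ∈ box m N k, (f (x + Pi.single i 1) + f x) =
      ∑ x ∈ (box m N k).filter (fun x => x i = 0), f x := by
  have e : ∑ x ∈ box m N k, f (x + Pi.single i 1) =
      ∑ x ∈ (box m N k).filter (fun x => ¬ x i = 0), f x := by
    rw [← Finset.sum_filter_add_sum_filter_not (box m N k) (fun x => x i = (N : ℤ) - 1)]
    rw [Finset.sum_eq_zero, zero_add]
    · refine Finset.sum_nbij' (fun x => x + Pi.single i 1) (fun x => x - Pi.single i 1)
        ?_ ?_ ?_ ?_ ?_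
      · intro x hx
        rw [Finset.mem_filter, mem_box] at hx ⊢
        obtain ⟨⟨h1, h2⟩, h3⟩ := hx
        have := h1 i hi
        refine ⟨⟨fun j hj => ?_, fun j hj => ?_⟩, ?_⟩
        · rcases eq_or_ne j i with rfl | hne
          · simp only [Pi.add_apply, Pi.single_eq_same]
            lia
          · simpa [hne] using h1 j hj
        · have hne : j ≠ i := by
            rintro rfl
            lia
          simpa [hne] using h2 j hj
        · simp only [Pi.add_apply, Pi.single_eq_same]
          lia
      · intro x hx
        rw [Finset.mem_filter, mem_box] at hx ⊢
        obtain ⟨⟨h1, h2⟩, h3⟩ := hx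
        have := h1 i hi
        refine ⟨⟨fun j hj => ?_, fun j hj => ?_⟩, ?_⟩
        · rcases eq_or_ne j i with rfl | hne
          · simp only [Pi.sub_apply, Pi.single_eq_same]
            lia
          · simpa [hne] using h1 j hj
        · have hne : j ≠ i := by
            rintro rfl
            lia
          simpa [hne] using h2 j hj
        · simp only [Pi.sub_apply, Pi.single_eq_same]
          lia
      · simp
      · simp
      · simp
    · intro x hx
      refine hf _ ?_
      simp [(Finset.mem_filter.1 hx).2]
  rw [Finset.sum_add_distrib, e, ← Finset.sum_filter_add_sum_filter_not (box m N k)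
    (fun x => x i = 0) f, add_comm, add_assoc, CharTwo.add_self_eq_zero, add_zero]

/-- Induction on the dimension of the box. Door counting reduces the full chains to chains on the
boundary with labels `0, …, k`. The far face in direction `i` lacks the label `i`, and the near face
with `i < k` has only labels up to `i`, so lacks `k`. Only the near face in direction `k` remains:
the box one dimension lower. -/
theorem sum_box_count {N : ℕ} (hN : 0 < N)
    (h0 : ∀ x (i : Fin m), x i ≤ 0 → ℓ x ≤ i)
    (h1 : ∀ x (i : Fin m), (N : ℤ) ≤ x i → ℓ x ≠ i) (hm : ∀ x, ℓ x ≤ m)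
    (k : ℕ) (hk : k ≤ m) :
    ∑ x ∈ box m N k, count ℓ k (Finset.univ.filter fun i => (i : ℕ) < k)
      (Finset.range (k + 1)) x = 1 := by
  induction k with
  | zero =>
    have hb : box m N 0 = {0} := by
      ext x
      rw [mem_box, Finset.mem_singleton]
      simp [funext_iff]
    have hl : ℓ 0 = 0 := by
      rcases Nat.eq_zero_or_pos m with h | h
      · have := hm 0
        lia
      · have := h0 0 ⟨0, h⟩ le_rfl
        simpa using this
    rw [hb, Finset.sum_singleton, count, if_pos (by simp [hl])]
  | succ k ih =>
    set S : Finset (Fin m) := Finset.univ.filter fun i => (i : ℕ) < k + 1 with hS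
    -- The only possible extra label is `k + 1`: if `k + 1 < m`, that coordinate vanishes throughout
    -- these chains, which bounds the labels by `k + 1`.
    have hlhs : ∀ x ∈ box m N (k + 1), count ℓ (k + 1) S (Finset.range (k + 1 + 1)) x =
        ∑ a ∈ (Finset.range (m + 1)).filter (· ∉ Finset.range (k + 1)),
          count ℓ (k + 1) S (insert a (Finset.range (k + 1))) x := by
      intro x hx
      rw [Finset.sum_eq_single (k + 1), Finset.range_add_one (n := k + 1)]
      · intro a ha hne
        by_contra hcon
        simp only [Finset.mem_filter, Finset.mem_range] at ha
        obtain ⟨y, -, hy, hya⟩ := exists_of_count_ne_zero ℓ _ _ _ _ hcon a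
          (Finset.mem_insert_self _ _)
        have hlt : k + 1 < m := by lia
        have hy0 := hy ⟨k + 1, hlt⟩ (by simp [hS])
        rw [(mem_box.1 hx).2 _ le_rfl] at hy0
        have := h0 y _ hy0.le
        simp only at this
        lia
      · intro h
        simp at h
        lia
    rw [Finset.sum_congr rfl hlhs,
      Finset.sum_congr rfl fun x _ => sum_count_insert ℓ (fun x => Nat.lt_succ_of_le (hm x)) k S
        (Finset.range (k + 1)) x, Finset.sum_comm]
    have hstep : ∀ i ∈ S, ∑ x ∈ box m N (k + 1),
        (count ℓ k (S.erase i) (Finset.range (k + 1)) (x + Pi.single i 1) +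
          count ℓ k (S.erase i) (Finset.range (k + 1)) x) =
        ∑ x ∈ (box m N (k + 1)).filter (fun x => x i = 0),
          count ℓ k (S.erase i) (Finset.range (k + 1)) x := by
      intro i hi
      have hi' : (i : ℕ) < k + 1 := (Finset.mem_filter.1 hi).2
      refine sum_box_diff _ i hi' fun x hx => ?_
      by_contra hcon
      obtain ⟨y, -, hy, hya⟩ := exists_of_count_ne_zero ℓ _ _ _ _ hcon i (by simpa using hi')
      refine h1 y i ?_ hya
      rw [hy i (Finset.notMem_erase _ _), hx]
    rw [Finset.sum_congr rfl hstep]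
    have hkm : k < m := hk
    rw [Finset.sum_eq_single ⟨k, hkm⟩]
    · rw [← ih (by lia)]
      have e1 : S.erase ⟨k, hkm⟩ = Finset.univ.filter fun i : Fin m => (i : ℕ) < k := by
        ext i
        simp only [hS, Finset.mem_erase, Finset.mem_filter, Finset.mem_univ, true_and, ne_eq,
          Fin.ext_iff]
        lia
      have e2 : (box m N (k + 1)).filter (fun x => x ⟨k, hkm⟩ = 0) = box m N k := by
        ext x
        rw [Finset.mem_filter, mem_box, mem_box]
        constructor
        · rintro ⟨⟨ha, hb⟩, hc⟩
          refine ⟨fun i hi => ha i (by lia), fun i hi => ?_⟩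
          rcases eq_or_ne i ⟨k, hkm⟩ with rfl | hne
          · exact hc
          · exact hb i (by
              have : (i : ℕ) ≠ k := fun e => hne (Fin.ext e)
              lia)
        · rintro ⟨ha, hb⟩
          refine ⟨⟨fun i hi => ?_, fun i hi => hb i (by lia)⟩, hb _ le_rfl⟩
          by_cases hik : (i : ℕ) < k
          · exact ha i hik
          · rw [hb i (by lia)]
            simpa using hN
      rw [e1, e2]
    · intro i hi hne
      have hi' : (i : ℕ) < k + 1 := (Finset.mem_filter.1 hi).2
      have hik : (i : ℕ) ≠ k := fun e => hne (Fin.ext e)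
      refine Finset.sum_eq_zero fun x hx => ?_
      by_contra hcon
      obtain ⟨y, -, hy, hya⟩ := exists_of_count_ne_zero ℓ _ _ _ _ hcon k (by simp)
      have := h0 y i (by rw [hy i (Finset.notMem_erase _ _), (Finset.mem_filter.1 hx).2])
      lia
    · intro h
      simp [hS] at h

/-- Kuhn's cubical form of Sperner's lemma. -/
theorem exists_labels {N : ℕ} (hN : 0 < N)
    (h0 : ∀ x (i : Fin m), x i ≤ 0 → ℓ x ≤ i)
    (h1 : ∀ x (i : Fin m), (N : ℤ) ≤ x i → ℓ x ≠ i) (hm : ∀ x, ℓ x ≤ m) :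
    ∃ x : Fin m → ℤ, ∀ a ≤ m, ∃ y : Fin m → ℤ, (∀ i, x i ≤ y i ∧ y i ≤ x i + 1) ∧ ℓ y = a := by
  have h := sum_box_count ℓ hN h0 h1 hm m le_rfl
  obtain ⟨x, -, hx⟩ := Finset.exists_ne_zero_of_sum_ne_zero (h ▸ one_ne_zero)
  refine ⟨x, fun a ha => ?_⟩
  obtain ⟨y, hy, -, hya⟩ := exists_of_count_ne_zero ℓ _ _ _ _ hx a (by simpa [Nat.lt_succ_iff])
  exact ⟨y, fun i => hy i (by simp), hya⟩

end Sperner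

/-! ## A lower bound for the asymptotic dimension -/

/-- Label a lattice point by a number depending only on the chosen member of the cover containing
its image. Then a cube with all `m + 1` labels yields `m + 1` different members meeting one small
ball. -/
theorem le_of_asdimLE {X : Type*} [PseudoEMetricSpace X] {m k : ℕ} (q : (Fin m → ℤ) → X)
    (C : ℝ≥0) (hq : ∀ y y' : Fin m → ℤ, (∀ i, |y i - y' i| ≤ 1) → edist (q y) (q y') ≤ C)
    (hq' : ∀ R : ℝ≥0, ∃ D : ℤ, ∀ y y', edist (q y) (q y') ≤ R → ∀ i, |y i - y' i| ≤ D)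
    (h : AsdimLE X k) : m ≤ k := by
  obtain ⟨U, hU, ⟨R, hR⟩, hmult⟩ := h (C + 1) (by positivity)
  have hA : ∀ y, ∃ A ∈ U, q y ∈ A := fun y => by
    have : q y ∈ ⋃₀ U := hU ▸ Set.mem_univ _
    exact this
  choose A hAU hqA using hA
  obtain ⟨D, hD⟩ := hq' R
  -- The directions in which `S` reaches the nonpositive side; `m` belongs vacuously and is the
  -- default label. As members of the cover are bounded, a point with `y i > D` cannot have label
  -- `i`.
  let low : Set X → Set ℕ := fun S => {a | ∀ h : a < m, ∃ z, z ⟨a, h⟩ ≤ 0 ∧ q z ∈ S}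
  have hlow : ∀ S, m ∈ low S := fun S h => absurd h (lt_irrefl m)
  obtain ⟨x, hx⟩ := Sperner.exists_labels (N := D.toNat + 1) (fun y => sInf (low (A y)))
    (Nat.succ_pos _) (fun y i hy => Nat.sInf_le fun _ => ⟨y, hy, hqA y⟩)
    (fun y i hy he => by
      have hmem := Nat.sInf_mem ⟨m, hlow (A y)⟩
      rw [he] at hmem
      obtain ⟨z, hz, hzA⟩ := hmem i.2
      have := hD y z (hR _ (hAU y) _ (hqA y) _ hzA) i
      have hz' : z i ≤ 0 := hz
      rw [abs_le] at this
      push_cast at hy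
      lia)
    (fun y => Nat.sInf_le (hlow _))
  choose! y hy hyl using hx
  have hinj : Function.Injective fun a : Fin (m + 1) => A (y a) := by
    intro a b hab
    have := congrArg (fun S => sInf (low S)) hab
    simp only [hyl a (Nat.lt_succ_iff.1 a.2), hyl b (Nat.lt_succ_iff.1 b.2)] at this
    exact Fin.ext this
  have hsub : Set.range (fun a : Fin (m + 1) => A (y a)) ⊆
      {A ∈ U | ∃ p ∈ A, edist p (q x) < (C + 1 : ℝ≥0)} := by
    rintro _ ⟨a, rfl⟩
    refine ⟨hAU _, _, hqA _, (hq _ _ fun i => ?_).trans_lt ?_⟩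
    · have := hy a (Nat.lt_succ_iff.1 a.2) i
      rw [abs_le]
      constructor <;> lia
    · exact_mod_cast lt_add_one C
  have := (Set.encard_le_encard hsub).trans (hmult (q x))
  rw [← Set.image_univ, hinj.encard_image, Set.encard_univ] at this
  simp only [ENat.card_eq_coe_fintype_card, Fintype.card_fin] at this
  have : m + 1 ≤ k + 1 := by exact_mod_cast this
  lia

/-! ## Intervals with gaps -/

theorem ediv_eq_of_emod_lt {P w x y : ℤ} (hP : 0 < P) (hx : x % P < P - w) (hy : y % P < P - w)
    (h : |x - y| ≤ w) : x / P = y / P := by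
  have h1 := Int.emod_add_mul_ediv x P
  have h2 := Int.emod_add_mul_ediv y P
  have h3 := Int.emod_nonneg x hP.ne'
  have h4 := Int.emod_nonneg y hP.ne'
  rw [abs_le] at h
  rcases lt_trichotomy (x / P) (y / P) with hlt | heq | hlt
  · nlinarith
  · exact heq
  · nlinarith

/-- The gaps of color `c` are the `c`-th blocks of length `w` modulo `n * w`, so gaps of different
colors are disjoint. -/
theorem ediv_eq_of_le_emod {n : ℕ} {w x : ℤ} (hw : 0 < w) {c : ℤ} (hc0 : 0 ≤ c) (hcn : c < n)
    (h : n * w - w ≤ (x - (c + 1) * w) % (n * w)) : (x % (n * w)) / w = c := by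
  have hP : 0 < n * w := mul_pos (by lia) hw
  have h1 := Int.emod_add_mul_ediv (x - (c + 1) * w) (n * w)
  have h2 := Int.emod_lt_of_pos (x - (c + 1) * w) hP
  set r := (x - (c + 1) * w) % (n * w)
  set t := (x - (c + 1) * w) / (n * w)
  have hx : x = (r - n * w + (c + 1) * w) + n * w * (t + 1) := by linarith
  rw [hx, Int.add_mul_emod_self_left, Int.emod_eq_of_lt (by nlinarith) (by nlinarith),
    Int.ediv_eq_iff_of_pos hw]
  constructor <;> nlinarith

/-- Pigeonhole: each of the `n - 1` coordinates other than `z` excludes at most one of the `n`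
colors. -/
theorem exists_color {n : ℕ} (z : Fin n) (a : Fin n → ℤ) {w : ℤ} (hw : 0 < w) :
    ∃ c : Fin n, ∀ j ≠ z, (a j - ((c : ℕ) + 1) * w) % (n * w) < n * w - w := by
  classical
  have hcard : ((Finset.univ.erase z).image fun j => (a j % (n * w)) / w).card <
      (Finset.Ico (0 : ℤ) n).card := by
    refine Finset.card_image_le.trans_lt ?_
    rw [Finset.card_erase_of_mem (Finset.mem_univ z), Finset.card_univ, Fintype.card_fin,
      Int.card_Ico]
    have := z.pos
    lia
  obtain ⟨c, hc, hc'⟩ := Finset.exists_mem_notMem_of_card_lt_card hcard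
  rw [Finset.mem_Ico] at hc
  lift c to ℕ using hc.1
  refine ⟨⟨c, by lia⟩, fun j hj => ?_⟩
  by_contra hcon
  exact hc' (Finset.mem_image.2 ⟨j, by simp [hj], ediv_eq_of_le_emod hw hc.1 hc.2 (not_lt.1 hcon)⟩)

namespace BruhatTits

variable {K : Type*} [Field K] {ν : AddValuation K (WithTop ℤ)} {π : K} {n : ℕ}

/-! ## Valuations and scaling -/

theorem uniformizer_ne_zero (hπ : ν π = 1) : π ≠ 0 := by
  rintro rfl
  simp at hπ

theorem val_inv_of_eq {c : K} {k : ℤ} (h : ν c = k) : ν c⁻¹ = ((-k : ℤ) : WithTop ℤ) := by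
  have hc : c ≠ 0 := by
    rintro rfl
    simp at h
  have e : ν c⁻¹ + ν c = 0 := by rw [← ν.map_mul, inv_mul_cancel₀ hc, ν.map_one]
  rw [h] at e
  have hne : ν c⁻¹ ≠ ⊤ := ν.ne_top_iff.2 (inv_ne_zero hc)
  generalize ν c⁻¹ = t at *
  lift t to ℤ using hne
  norm_cast at *
  lia

theorem val_zpow (hπ : ν π = 1) (k : ℤ) : ν (π ^ k) = k := by
  have hpow : ∀ m : ℕ, ν (π ^ m) = ((m : ℤ) : WithTop ℤ) := by
    intro m
    induction m with
    | zero => simp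
    | succ m ih => rw [pow_succ, ν.map_mul, ih, hπ]; norm_cast
  obtain ⟨m, rfl | rfl⟩ := k.eq_nat_or_neg
  · rw [zpow_natCast, hpow]
  · rw [zpow_neg, zpow_natCast, val_inv_of_eq (hpow m)]

theorem exists_val_eq {c : K} (hc : c ≠ 0) : ∃ k : ℤ, ν c = k := by
  have h := ν.ne_top_iff.2 hc
  generalize ν c = t at *
  lift t to ℤ using h
  exact ⟨t, rfl⟩

theorem smul_mem_of_val_nonneg (L : Submodule (ringOfIntegers ν) (Fin n → K)) {c : K}
    (hc : 0 ≤ ν c) {x : Fin n → K} (hx : x ∈ L) : c • x ∈ L :=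
  L.smul_mem (⟨c, hc⟩ : ringOfIntegers ν) hx

theorem smul_mem_of_val_le (L : Submodule (ringOfIntegers ν) (Fin n → K)) {a b : K}
    (ha : a ≠ 0) (h : ν a ≤ ν b) {x : Fin n → K} (hx : a • x ∈ L) : b • x ∈ L := by
  have : b • x = (b * a⁻¹) • a • x := by
    rw [smul_smul, mul_assoc, inv_mul_cancel₀ ha, mul_one]
  rw [this]
  refine smul_mem_of_val_nonneg L ?_ hx
  obtain ⟨k, hk⟩ := exists_val_eq (ν := ν) ha
  rw [ν.map_mul, val_inv_of_eq hk]
  rw [hk] at h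
  generalize ν b = t at *
  induction t using WithTop.recTopCoe with
  | top => simp
  | coe t =>
    norm_cast at *
    lia

theorem zpow_smul_mem_mono (hπ : ν π = 1) (L : Submodule (ringOfIntegers ν) (Fin n → K))
    {j k : ℤ} (h : j ≤ k) {x : Fin n → K} (hx : π ^ j • x ∈ L) : π ^ k • x ∈ L :=
  smul_mem_of_val_le L (zpow_ne_zero _ (uniformizer_ne_zero hπ))
    (by rw [val_zpow hπ, val_zpow hπ]; exact_mod_cast h) hx

theorem mem_smul_iff {a : K} (ha : a ≠ 0) (L : Submodule (ringOfIntegers ν) (Fin n → K))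
    {x : Fin n → K} : x ∈ a • L ↔ a⁻¹ • x ∈ L := by
  rw [Submodule.mem_smul_pointwise_iff_exists]
  constructor
  · rintro ⟨y, hy, rfl⟩
    rwa [inv_smul_smul₀ ha]
  · exact fun h => ⟨_, h, smul_inv_smul₀ ha x⟩

theorem mem_zpow_smul_iff (hπ : ν π = 1) (L : Submodule (ringOfIntegers ν) (Fin n → K))
    (k : ℤ) {x : Fin n → K} : x ∈ π ^ k • L ↔ π ^ (-k) • x ∈ L := by
  rw [mem_smul_iff (zpow_ne_zero _ (uniformizer_ne_zero hπ)), zpow_neg]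

theorem mem_inv_smul_iff (hπ : ν π = 1) (L : Submodule (ringOfIntegers ν) (Fin n → K))
    {x : Fin n → K} : x ∈ π⁻¹ • L ↔ π • x ∈ L := by
  rw [mem_smul_iff (inv_ne_zero (uniformizer_ne_zero hπ)), inv_inv]

theorem zpow_smul_zpow_smul (hπ : ν π = 1) (j k : ℤ) (x : Fin n → K) :
    π ^ j • π ^ k • x = π ^ (j + k) • x := by
  rw [smul_smul, zpow_add₀ (uniformizer_ne_zero hπ)]

/-! ## The order of a vector with respect to a lattice -/

theorem exists_zpow_smul_mem (hπ : ν π = 1) (L : Lattice ν n) (w : Fin n → K) :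
    ∃ k : ℤ, π ^ k • w ∈ L.1 := by
  have hw : w ∈ Submodule.span K (L.1 : Set (Fin n → K)) := by
    rw [L.2.span_eq_top]
    trivial
  induction hw using Submodule.span_induction with
  | mem x hx => exact ⟨0, by simpa using hx⟩
  | zero => exact ⟨0, by simp⟩
  | add x y _ _ hx hy =>
    obtain ⟨j, hj⟩ := hx
    obtain ⟨k, hk⟩ := hy
    refine ⟨max j k, ?_⟩
    rw [smul_add]
    exact L.1.add_mem (zpow_smul_mem_mono hπ _ (le_max_left _ _) hj)
      (zpow_smul_mem_mono hπ _ (le_max_right _ _) hk)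
  | smul c x _ hx =>
    obtain ⟨k, hk⟩ := hx
    rcases eq_or_ne c 0 with rfl | hc
    · exact ⟨0, by simp⟩
    · obtain ⟨m, hm⟩ := exists_val_eq (ν := ν) hc
      refine ⟨k - m, ?_⟩
      rw [smul_smul]
      refine smul_mem_of_val_le L.1 (zpow_ne_zero k (uniformizer_ne_zero hπ)) ?_ hk
      rw [ν.map_mul, hm, val_zpow hπ, val_zpow hπ]
      norm_cast
      lia

theorem exists_val_lower_bound (L : Lattice ν n) :
    ∃ N : ℤ, ∀ x ∈ L.1, ∀ i, (N : WithTop ℤ) ≤ ν (x i) := by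
  obtain ⟨S, hS⟩ := L.2.fg
  have hb : ∀ x : Fin n → K, ∃ N : ℤ, ∀ i, (N : WithTop ℤ) ≤ ν (x i) := by
    intro x
    have h1 : ∀ i, ∃ N : ℤ, (N : WithTop ℤ) ≤ ν (x i) := by
      intro i
      rcases eq_or_ne (x i) 0 with h | h
      · exact ⟨0, by simp [h]⟩
      · obtain ⟨k, hk⟩ := exists_val_eq (ν := ν) h
        exact ⟨k, hk.ge⟩
    choose f hf using h1
    obtain ⟨N, hN⟩ := (Set.finite_range f).bddBelow
    exact ⟨N, fun i => le_trans (by exact_mod_cast hN ⟨i, rfl⟩) (hf i)⟩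
  choose g hg using hb
  obtain ⟨N, hN⟩ := (S.finite_toSet.image g).bddBelow
  refine ⟨N, fun x hx => ?_⟩
  rw [← hS] at hx
  induction hx using Submodule.span_induction with
  | mem x hx =>
    exact fun i => le_trans (by exact_mod_cast hN ⟨x, hx, rfl⟩) (hg x i)
  | zero => simp
  | add x y _ _ hx hy => exact fun i => ν.map_le_add (hx i) (hy i)
  | smul c x _ hx =>
    intro i
    have hc : 0 ≤ ν (c : K) := c.2
    change _ ≤ ν ((c : K) * x i)
    rw [ν.map_mul]
    exact le_add_of_nonneg_of_le hc (hx i)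

theorem exists_ord (hπ : ν π = 1) (L : Lattice ν n) {w : Fin n → K} (hw : w ≠ 0) :
    ∃ m : ℤ, ∀ k : ℤ, π ^ k • w ∈ L.1 ↔ -m ≤ k := by
  obtain ⟨N, hN⟩ := exists_val_lower_bound L
  obtain ⟨i, hi⟩ := Function.ne_iff.1 hw
  obtain ⟨c, hc⟩ := exists_val_eq (ν := ν) hi
  obtain ⟨k₀, hk₀, hmin⟩ := Int.exists_least_of_bdd (P := fun k : ℤ => π ^ k • w ∈ L.1)
    ⟨N - c, fun z hz => by
      have := hN _ hz i
      rw [Pi.smul_apply, smul_eq_mul, ν.map_mul, hc, val_zpow hπ] at this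
      norm_cast at this
      lia⟩ (exists_zpow_smul_mem hπ L w)
  refine ⟨-k₀, fun k => ⟨fun h => by simpa using hmin k h, fun h => ?_⟩⟩
  exact zpow_smul_mem_mono hπ _ (by lia) hk₀

open Classical in
/-- The largest `m` such that `w ∈ π ^ m L`; zero for `w = 0`. -/
def ord (π : K) (L : Lattice ν n) (w : Fin n → K) : ℤ :=
  if h : ∃ m : ℤ, ∀ k : ℤ, π ^ k • w ∈ L.1 ↔ -m ≤ k then h.choose else 0

theorem zpow_smul_mem_iff (hπ : ν π = 1) (L : Lattice ν n) {w : Fin n → K} (hw : w ≠ 0)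
    (k : ℤ) : π ^ k • w ∈ L.1 ↔ -ord π L w ≤ k := by
  have h := exists_ord hπ L hw
  rw [ord, dif_pos h]
  exact h.choose_spec k

theorem mem_iff_ord_nonneg (hπ : ν π = 1) (L : Lattice ν n) {w : Fin n → K} (hw : w ≠ 0) :
    w ∈ L.1 ↔ 0 ≤ ord π L w := by
  have := zpow_smul_mem_iff hπ L hw 0
  rw [zpow_zero, one_smul] at this
  rw [this]
  lia

theorem ord_eq_of_forall (hπ : ν π = 1) (L : Lattice ν n) {w : Fin n → K} (hw : w ≠ 0) {m : ℤ}
    (h : ∀ k : ℤ, π ^ k • w ∈ L.1 ↔ -m ≤ k) : ord π L w = m := by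
  have h1 := (zpow_smul_mem_iff hπ L hw (-m)).1 ((h _).2 le_rfl)
  have h2 := (h (-ord π L w)).1 ((zpow_smul_mem_iff hπ L hw _).2 le_rfl)
  lia

theorem ord_mono (hπ : ν π = 1) {L M : Lattice ν n} (h : L.1 ≤ M.1) {w : Fin n → K}
    (hw : w ≠ 0) : ord π L w ≤ ord π M w := by
  have := (zpow_smul_mem_iff hπ M hw (-ord π L w)).1
    (h ((zpow_smul_mem_iff hπ L hw _).2 le_rfl))
  lia

theorem ord_of_eq_smul (hπ : ν π = 1) {L M : Lattice ν n} {a : K} {k : ℤ} (ha : ν a = k)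
    (h : M.1 = a • L.1) {w : Fin n → K} (hw : w ≠ 0) : ord π M w = ord π L w - k := by
  have ha0 : a ≠ 0 := by
    rintro rfl
    simp at ha
  refine ord_eq_of_forall hπ M hw fun j => ?_
  have hpi := uniformizer_ne_zero hπ
  have e : π ^ j • w ∈ M.1 ↔ π ^ (j - k) • w ∈ L.1 := by
    rw [h, mem_smul_iff ha0, smul_smul]
    have hv : ν (a⁻¹ * π ^ j) = ν (π ^ (j - k)) := by
      rw [ν.map_mul, val_inv_of_eq ha, val_zpow hπ, val_zpow hπ]
      norm_cast
      lia
    exact ⟨smul_mem_of_val_le _ (mul_ne_zero (inv_ne_zero ha0) (zpow_ne_zero _ hpi)) hv.le,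
      smul_mem_of_val_le _ (zpow_ne_zero _ hpi) hv.ge⟩
  rw [e, zpow_smul_mem_iff hπ L hw]
  lia

/-- The multiple of a lattice by a power of the uniformizer. -/
def scale (hπ : ν π = 1) (k : ℤ) (L : Lattice ν n) : Lattice ν n :=
  ⟨π ^ k • L.1, by
    have := L.2
    exact Submodule.IsLattice.smul (A := K) (M := L.1)
      (Units.mk0 (π ^ k) (zpow_ne_zero k (uniformizer_ne_zero hπ)))⟩

theorem mem_scale (hπ : ν π = 1) (k : ℤ) (L : Lattice ν n) {x : Fin n → K} :
    x ∈ (scale hπ k L).1 ↔ π ^ (-k) • x ∈ L.1 :=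
  mem_zpow_smul_iff hπ L.1 k

theorem cls_scale (hπ : ν π = 1) (k : ℤ) (L : Lattice ν n) : (scale hπ k L).cls = L.cls :=
  (Quotient.sound (s := homothety ν n)
    ⟨Units.mk0 (π ^ k) (zpow_ne_zero k (uniformizer_ne_zero hπ)), rfl⟩).symm

theorem ord_scale (hπ : ν π = 1) (k : ℤ) (L : Lattice ν n) {w : Fin n → K} (hw : w ≠ 0) :
    ord π (scale hπ k L) w = ord π L w - k :=
  ord_of_eq_smul hπ (val_zpow hπ k) rfl hw

theorem exists_eq_scale (hπ : ν π = 1) {L M : Lattice ν n} (h : L.cls = M.cls) :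
    ∃ k, M = scale hπ k L := by
  obtain ⟨a, ha⟩ : ∃ a : Kˣ, M.1 = a • L.1 := Quotient.exact h
  obtain ⟨k, hk⟩ := exists_val_eq (ν := ν) a.ne_zero
  refine ⟨k, Subtype.ext (Submodule.ext fun x => ?_)⟩
  have h0 := zpow_ne_zero (-k) (uniformizer_ne_zero hπ)
  have hv : ν (a : K)⁻¹ = ν (π ^ (-k)) := by rw [val_inv_of_eq hk, val_zpow hπ]
  rw [mem_scale, ha]
  change x ∈ (a : K) • L.1 ↔ _
  rw [mem_smul_iff a.ne_zero]
  exact ⟨smul_mem_of_val_le _ (inv_ne_zero a.ne_zero) hv.le, smul_mem_of_val_le _ h0 hv.ge⟩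

/-! ## The ring of integers -/

theorem ringOfIntegers_isUnit_iff (u : ringOfIntegers ν) : IsUnit u ↔ ν (u : K) = 0 := by
  constructor
  · rintro ⟨v, rfl⟩
    have h : ν ((v : ringOfIntegers ν) : K) + ν ((v⁻¹ : (ringOfIntegers ν)ˣ) : K) = 0 := by
      rw [← ν.map_mul, ← ν.map_one]
      congr 1
      exact_mod_cast congrArg Subtype.val (Units.mul_inv v)
    have h1 : 0 ≤ ν ((v : ringOfIntegers ν) : K) := (v : ringOfIntegers ν).2
    have h2 : 0 ≤ ν ((v⁻¹ : (ringOfIntegers ν)ˣ) : K) := ((v⁻¹ : (ringOfIntegers ν)ˣ) : ringOfIntegers ν).2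
    exact (add_eq_zero_iff_of_nonneg h1 h2).1 h |>.1
  · intro h
    have h0 : (u : K) ≠ 0 := by
      intro e
      rw [e] at h
      simp at h
    have hinv : ν (u : K)⁻¹ = 0 := by simpa using val_inv_of_eq (k := 0) (by simpa using h)
    exact IsUnit.of_mul_eq_one ⟨(u : K)⁻¹, hinv.ge⟩ (Subtype.ext (mul_inv_cancel₀ h0))

/-- The uniformizer as an element of the ring of integers. -/
def integralUniformizer (hπ : ν π = 1) : ringOfIntegers ν :=
  ⟨π, show 0 ≤ ν π by rw [hπ]; exact zero_le_one⟩

theorem associated_pow (hπ : ν π = 1) {x : ringOfIntegers ν} (hx : x ≠ 0) :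
    ∃ k : ℕ, Associated (integralUniformizer hπ ^ k) x ∧ ν (x : K) = (k : ℤ) := by
  have hx0 : (x : K) ≠ 0 := fun h => hx (Subtype.ext h)
  obtain ⟨k, hk⟩ := exists_val_eq (ν := ν) hx0
  have hk0 : 0 ≤ ν (x : K) := x.2
  rw [hk] at hk0
  obtain ⟨k, rfl⟩ := Int.eq_ofNat_of_zero_le (by exact_mod_cast hk0 : 0 ≤ k)
  have hp := zpow_ne_zero (k : ℤ) (uniformizer_ne_zero hπ)
  have hv : ν ((x : K) * (π ^ (k : ℤ))⁻¹) = 0 := by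
    rw [ν.map_mul, val_inv_of_eq (val_zpow hπ _), hk]
    norm_cast
    lia
  have hu : IsUnit (⟨(x : K) * (π ^ (k : ℤ))⁻¹, hv.ge⟩ : ringOfIntegers ν) :=
    (ringOfIntegers_isUnit_iff _).2 hv
  obtain ⟨u, hu⟩ := hu
  refine ⟨k, ⟨u, ?_⟩, hk⟩
  rw [hu]
  refine Subtype.ext ?_
  change (π ^ k) * ((x : K) * (π ^ (k : ℤ))⁻¹) = x
  rw [mul_comm, mul_assoc, ← zpow_natCast, inv_mul_cancel₀ hp, mul_one]

theorem irreducible_integralUniformizer (hπ : ν π = 1) : Irreducible (integralUniformizer hπ) := by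
  refine ⟨fun h => ?_, fun a b hab => ?_⟩
  · have := (ringOfIntegers_isUnit_iff _).1 h
    change ν π = 0 at this
    rw [hπ] at this
    exact one_ne_zero this
  · have h : ν (a : K) + ν (b : K) = 1 := by
      rw [← ν.map_mul, ← hπ]
      exact congrArg ν (congrArg Subtype.val hab).symm
    rw [ringOfIntegers_isUnit_iff, ringOfIntegers_isUnit_iff]
    have ha : 0 ≤ ν (a : K) := a.2
    have hb : 0 ≤ ν (b : K) := b.2
    generalize ν (a : K) = s at *
    generalize ν (b : K) = t at *
    induction s using WithTop.recTopCoe with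
    | top => simp at h
    | coe s =>
      induction t using WithTop.recTopCoe with
      | top => simp at h
      | coe t =>
        norm_cast at *
        lia

theorem isDiscreteValuationRing (hπ : ν π = 1) : IsDiscreteValuationRing (ringOfIntegers ν) :=
  IsDiscreteValuationRing.ofHasUnitMulPowIrreducibleFactorization
    ⟨integralUniformizer hπ, irreducible_integralUniformizer hπ, fun hx => by
      obtain ⟨k, hk, -⟩ := associated_pow hπ hx
      exact ⟨k, hk⟩⟩

/-! ## Lengths of quotients of lattices -/

/-- `π⁻¹ L / L` is generated by the `n` images of a basis, each killed by `π`, hence is a quotient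
of a sum of `n` copies of the residue field. -/
theorem length_quotient_le (hπ : ν π = 1) (L : Lattice ν n) :
    Module.length (ringOfIntegers ν)
      ((scale hπ (-1) L).1 ⧸ L.1.submoduleOf (scale hπ (-1) L).1) ≤ n := by
  have := isDiscreteValuationRing hπ
  set M := scale hπ (-1) L with hM
  have hMl := M.2
  have hfr : Module.finrank (ringOfIntegers ν) M.1 = n := by
    rw [Submodule.IsLattice.finrank_of_pi (K := K), Fintype.card_fin]
  have : Module.Free (ringOfIntegers ν) M.1 := Submodule.IsLattice.free (K := K) M.1
  let b := Module.finBasisOfFinrankEq (ringOfIntegers ν) M.1 hfr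
  have hirr := irreducible_integralUniformizer hπ
  let I : Ideal (ringOfIntegers ν) := Ideal.span {integralUniformizer hπ}
  have hmax : I.IsMaximal := PrincipalIdealRing.isMaximal_of_irreducible hirr
  have hsimple : IsSimpleModule (ringOfIntegers ν) (ringOfIntegers ν ⧸ I) :=
    isSimpleModule_iff_isCoatom.2 hmax.out
  let N := L.1.submoduleOf M.1
  let q : Fin n → (ringOfIntegers ν ⧸ I) →ₗ[ringOfIntegers ν] (M.1 ⧸ N) := fun i =>
    I.liftQ ((LinearMap.toSpanSingleton _ _ (N.mkQ (b i)))) (by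
      rw [Ideal.span_le, Set.singleton_subset_iff, SetLike.mem_coe, LinearMap.mem_ker,
        LinearMap.toSpanSingleton_apply, ← map_smul, Submodule.mkQ_apply,
        Submodule.Quotient.mk_eq_zero]
      have h := (mem_scale hπ (-1) L).1 (b i).2
      rw [neg_neg, zpow_one] at h
      exact h)
  let g : (Fin n → ringOfIntegers ν ⧸ I) →ₗ[ringOfIntegers ν] (M.1 ⧸ N) :=
    LinearMap.lsum (ringOfIntegers ν) (fun _ => ringOfIntegers ν ⧸ I) (ringOfIntegers ν) q
  have hg : Function.Surjective g := by
    intro y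
    obtain ⟨x, rfl⟩ := N.mkQ_surjective y
    refine ⟨fun i => I.mkQ (b.repr x i), ?_⟩
    conv_rhs => rw [← b.sum_repr x, map_sum]
    simp only [g, LinearMap.lsum_apply, LinearMap.sum_apply, LinearMap.comp_apply,
      LinearMap.proj_apply, q]
    exact Finset.sum_congr rfl fun i _ => (map_smul N.mkQ (b.repr x i) (b i)).symm
  refine (Module.length_le_of_surjective g hg).trans ?_
  rw [Module.length_pi_of_fintype]
  simp

/-- The map of quotients by `L` induced by an inclusion `M ≤ N`. -/
def quotientInclusion (L : Submodule (ringOfIntegers ν) (Fin n → K))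
    {M N : Submodule (ringOfIntegers ν) (Fin n → K)} (h : M ≤ N) :
    (M ⧸ L.submoduleOf M) →ₗ[ringOfIntegers ν] (N ⧸ L.submoduleOf N) :=
  (L.submoduleOf M).mapQ (L.submoduleOf N) (Submodule.inclusion h) fun _ hx => hx

theorem quotientInclusion_mk (L : Submodule (ringOfIntegers ν) (Fin n → K))
    {M N : Submodule (ringOfIntegers ν) (Fin n → K)} (h : M ≤ N) (x : M) :
    quotientInclusion L h ((L.submoduleOf M).mkQ x) =
      (L.submoduleOf N).mkQ (Submodule.inclusion h x) :=
  rfl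

theorem quotientInclusion_injective (L : Submodule (ringOfIntegers ν) (Fin n → K))
    {M N : Submodule (ringOfIntegers ν) (Fin n → K)} (h : M ≤ N) :
    Function.Injective (quotientInclusion L h) := by
  rw [injective_iff_map_eq_zero]
  intro y hy
  obtain ⟨x, rfl⟩ := (L.submoduleOf M).mkQ_surjective y
  rw [quotientInclusion_mk, Submodule.mkQ_apply, Submodule.Quotient.mk_eq_zero] at hy
  rw [Submodule.mkQ_apply, Submodule.Quotient.mk_eq_zero]
  exact hy

theorem length_quotient_lt {L M N : Submodule (ringOfIntegers ν) (Fin n → K)} (hL : L ≤ M)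
    (h : M < N) (hfin : Module.length (ringOfIntegers ν) (N ⧸ L.submoduleOf N) ≠ ⊤) :
    Module.length (ringOfIntegers ν) (M ⧸ L.submoduleOf M) <
      Module.length (ringOfIntegers ν) (N ⧸ L.submoduleOf N) := by
  obtain ⟨hN, hA⟩ := isFiniteLength_iff_isNoetherian_isArtinian.1 (Module.length_ne_top_iff.1 hfin)
  rw [(LinearEquiv.ofInjective _ (quotientInclusion_injective L h.le)).length_eq]
  refine Submodule.length_lt fun htop => ?_
  obtain ⟨x, hxN, hxM⟩ := SetLike.exists_of_lt h
  have hx : (L.submoduleOf N).mkQ ⟨x, hxN⟩ ∈ LinearMap.range (quotientInclusion L h.le) :=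
    htop ▸ trivial
  obtain ⟨y, hy⟩ := hx
  obtain ⟨y, rfl⟩ := (L.submoduleOf M).mkQ_surjective y
  rw [quotientInclusion_mk, Submodule.mkQ_apply, Submodule.mkQ_apply, Submodule.Quotient.eq] at hy
  have hy' : (y : Fin n → K) - x ∈ L := hy
  refine hxM ?_
  have := M.sub_mem y.2 (hL hy')
  simpa using this

theorem IsLatticeChain.zero_le {m : ℕ} {L : Fin (m + 1) → Lattice ν n} (hL : IsLatticeChain π L)
    (i : Fin (m + 1)) : (L 0).1 ≤ (L i).1 :=
  hL.1.monotone (Fin.zero_le i)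

theorem IsLatticeChain.lt_inv_smul {m : ℕ} {L : Fin (m + 1) → Lattice ν n}
    (hL : IsLatticeChain π L) (i : Fin (m + 1)) : (L i).1 < π⁻¹ • (L 0).1 :=
  lt_of_le_of_lt (hL.1.monotone (Fin.le_last i)) hL.2

theorem IsLatticeChain.length_lt (hπ : ν π = 1) {m : ℕ} {L : Fin (m + 1) → Lattice ν n}
    (hL : IsLatticeChain π L) (i : Fin (m + 1)) :
    Module.length (ringOfIntegers ν) ((L i).1 ⧸ (L 0).1.submoduleOf (L i).1) < n := by
  have hlt : (L i).1 < (scale hπ (-1) (L 0)).1 := by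
    change _ < π ^ (-1 : ℤ) • _
    rw [zpow_neg_one]
    exact hL.lt_inv_smul i
  have hle := length_quotient_le hπ (L 0)
  exact (length_quotient_lt (hL.zero_le i) hlt
    (ne_top_of_le_ne_top (ENat.natCast_ne_top n) hle)).trans_le hle

theorem IsLatticeChain.relLength_lt (hπ : ν π = 1) {m : ℕ} {L : Fin (m + 1) → Lattice ν n}
    (hL : IsLatticeChain π L) (i : Fin (m + 1)) : relLength (L 0) (L i) < n := by
  have h := hL.length_lt hπ i
  rw [relLength]
  rw [← ENat.natCast_toNat (ne_top_of_lt h)] at h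
  exact_mod_cast h

theorem IsLatticeChain.relLength_strictMono (hπ : ν π = 1) {m : ℕ}
    {L : Fin (m + 1) → Lattice ν n} (hL : IsLatticeChain π L) :
    StrictMono fun i => relLength (L 0) (L i) := by
  intro i j hij
  have hj := ne_top_of_lt (hL.length_lt hπ j)
  have h := length_quotient_lt (hL.zero_le i) (hL.1 hij : (L i).1 < (L j).1) hj
  simp only [relLength]
  rw [← ENat.natCast_toNat hj, ← ENat.natCast_toNat (ne_top_of_lt h)] at h
  exact_mod_cast h

/-! ## Normalized orders on vertices -/

/-- The order of `w` with respect to a lattice in the class `v`, minus the order of `e`. -/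
def relOrd (π : K) (e : Fin n → K) (v : Vertex ν n) (w : Fin n → K) : ℤ :=
  ord π v.out w - ord π v.out e

variable {e : Fin n → K}

theorem relOrd_cls (hπ : ν π = 1) (he : e ≠ 0) (L : Lattice ν n) {w : Fin n → K} (hw : w ≠ 0) :
    relOrd π e L.cls w = ord π L w - ord π L e := by
  obtain ⟨k, hk⟩ := exists_eq_scale hπ (Quotient.out_eq L.cls)
  have h : ∀ x : Fin n → K, x ≠ 0 → ord π L x = ord π (Quotient.out L.cls) x - k := by
    intro x hx
    conv_lhs => rw [hk]
    exact ord_scale hπ k _ hx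
  rw [relOrd, h w hw, h e he]
  ring

/-- From `L` to `M` the orders of `w` and of `e` each grow by 0 or 1, so their difference moves by
at most 1. -/
theorem abs_relOrd_sub_le (hπ : ν π = 1) (he : e ≠ 0) {L M : Lattice ν n} (h1 : L.1 ≤ M.1)
    (h2 : M.1 ≤ π⁻¹ • L.1) {w : Fin n → K} (hw : w ≠ 0) :
    |relOrd π e M.cls w - relOrd π e L.cls w| ≤ 1 := by
  have h2' : M.1 ≤ (scale hπ (-1) L).1 := by
    change _ ≤ π ^ (-1 : ℤ) • _
    rwa [zpow_neg_one]
  rw [relOrd_cls hπ he M hw, relOrd_cls hπ he L hw, abs_le]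
  have a1 := ord_mono hπ h1 hw
  have a2 := ord_mono hπ h1 he
  have b1 := ord_mono hπ h2' hw
  have b2 := ord_mono hπ h2' he
  rw [ord_scale hπ _ _ hw] at b1
  rw [ord_scale hπ _ _ he] at b2
  constructor <;> lia

theorem IsLatticeChain.abs_relOrd_sub_le (hπ : ν π = 1) (he : e ≠ 0) {m : ℕ}
    {L : Fin (m + 1) → Lattice ν n} (hL : IsLatticeChain π L) {w : Fin n → K} (hw : w ≠ 0)
    (i j : Fin (m + 1)) :
    |relOrd π e (L i).cls w - relOrd π e (L j).cls w| ≤ 1 := by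
  have key : ∀ i j : Fin (m + 1), i ≤ j →
      |relOrd π e (L j).cls w - relOrd π e (L i).cls w| ≤ 1 := by
    intro i j hij
    refine BruhatTits.abs_relOrd_sub_le hπ he (hL.1.monotone hij) ?_ hw
    exact (hL.lt_inv_smul j).le.trans (Submodule.map_mono (hL.zero_le i))
  rcases le_total i j with h | h
  · rw [abs_sub_comm]
    exact key i j h
  · exact key j i h

namespace AffineBuilding

/-! ## Barycentric coordinates in a closed simplex -/

theorem sum_eq_of_liesIn (hπ : ν π = 1) {m : ℕ} {L : Fin (m + 1) → Lattice ν n}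
    (hL : IsLatticeChain π L) {x : AffineBuilding ν π n} (hx : x.LiesIn L)
    (f : Vertex ν n → ℝ) :
    (x.coord.sum fun v t => t * f v) = ∑ i, x.coord (L i).cls * f (L i).cls := by
  classical
  have hinj := hL.cls_injective hπ
  rw [← Finset.sum_image (f := fun v => x.coord v * f v) (s := Finset.univ)
    (g := fun i => (L i).cls) (fun i _ j _ h => hinj h)]
  refine Finset.sum_subset (fun v hv => ?_) fun v _ hv => ?_
  · obtain ⟨i, hi⟩ := hx v (Finsupp.mem_support_iff.1 hv)
    exact Finset.mem_image.2 ⟨i, Finset.mem_univ _, hi⟩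
  · simp [Finsupp.notMem_support_iff.1 hv]

theorem sum_coord_of_liesIn (hπ : ν π = 1) {m : ℕ} {L : Fin (m + 1) → Lattice ν n}
    (hL : IsLatticeChain π L) {x : AffineBuilding ν π n} (hx : x.LiesIn L) :
    ∑ i, x.coord (L i).cls = 1 := by
  have h := sum_eq_of_liesIn hπ hL hx fun _ => 1
  simp only [mul_one] at h
  rw [← h, x.sum_coord]

theorem exists_liesIn (x : AffineBuilding ν π n) :
    ∃ (m : ℕ) (L : Fin (m + 1) → Lattice ν n), IsLatticeChain π L ∧ x.LiesIn L ∧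
      ∀ i, x.coord (L i).cls ≠ 0 := by
  obtain ⟨m, L, hL, h⟩ := x.support_mem
  refine ⟨m, L, hL, fun v hv => ?_, fun i => ?_⟩
  · have : v ∈ (x.coord.support : Set (Vertex ν n)) := Finsupp.mem_support_iff.2 hv
    rwa [h] at this
  · have : (L i).cls ∈ (x.coord.support : Set (Vertex ν n)) := h ▸ ⟨i, rfl⟩
    exact Finsupp.mem_support_iff.1 this

theorem alcoveVertex_sub {k j : ℕ} (hj : j + 1 < n) :
    alcoveVertex n k ⟨j, by lia⟩ - alcoveVertex n k ⟨j + 1, hj⟩ = if k = j + 1 then 1 else 0 := by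
  simp only [alcoveVertex]
  have h1 : j < k ↔ (k = j + 1 ∨ j + 1 < k) := by lia
  by_cases h : k = j + 1
  · subst h
    simp
  · simp [h1, h]

theorem chart_apply {m : ℕ} (L : Fin (m + 1) → Lattice ν n) (x : AffineBuilding ν π n)
    (j : Fin n) :
    chart L x j = ∑ i, x.coord (L i).cls * alcoveVertex n (relLength (L 0) (L i)) j := by
  simp [chart]

/-- A barycentric coordinate as the difference of two coordinates of the chart. -/
theorem coord_eq_chart_sub (hπ : ν π = 1) {m : ℕ} {L : Fin (m + 1) → Lattice ν n}
    (hL : IsLatticeChain π L) (i : Fin (m + 1)) (hi : i ≠ 0) :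
    ∃ j j' : Fin n, ∀ x : AffineBuilding ν π n,
      x.coord (L i).cls = chart L x j - chart L x j' := by
  have hmono := hL.relLength_strictMono hπ
  have hpos : 0 < relLength (L 0) (L i) :=
    lt_of_le_of_lt (Nat.zero_le _) (hmono (Fin.pos_iff_ne_zero.2 hi))
  obtain ⟨j, hj⟩ := Nat.exists_eq_succ_of_ne_zero hpos.ne'
  have hlt := hL.relLength_lt hπ i
  have hj' : j + 1 < n := by lia
  -- Coordinates `j` and `j + 1` of `ω_k` differ only for `k = j + 1`, and in a chain only `L i` has
  -- this relative length.
  refine ⟨⟨j, by lia⟩, ⟨j + 1, hj'⟩, fun x => ?_⟩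
  rw [chart_apply, chart_apply, ← Finset.sum_sub_distrib, Finset.sum_eq_single i]
  · rw [← mul_sub, alcoveVertex_sub, if_pos (by lia), mul_one]
  · intro k _ hk
    rw [← mul_sub, alcoveVertex_sub, if_neg, mul_zero]
    intro h
    exact hk (hmono.injective (by lia))
  · simp

theorem abs_coord_sub_le (hπ : ν π = 1) {m : ℕ} {L : Fin (m + 1) → Lattice ν n}
    (hL : IsLatticeChain π L) (i : Fin (m + 1)) (hi : i ≠ 0) (x y : AffineBuilding ν π n) :
    |x.coord (L i).cls - y.coord (L i).cls| ≤ 2 * dist (chart L x) (chart L y) := by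
  obtain ⟨j, j', h⟩ := coord_eq_chart_sub hπ hL i hi
  have hb : ∀ j, |chart L x j - chart L y j| ≤ dist (chart L x) (chart L y) := by
    intro j
    have := PiLp.norm_apply_le (chart L x - chart L y) j
    rw [dist_eq_norm]
    simpa using this
  rw [h x, h y]
  have e : chart L x j - chart L x j' - (chart L y j - chart L y j') =
    (chart L x j - chart L y j) - (chart L x j' - chart L y j') := by ring
  rw [e]
  refine (abs_sub _ _).trans ?_
  linarith [hb j, hb j']

/-! ### Lipschitz bounds for normalized orders -/

/-- The affine extension of `relOrd` to the building. -/
def realOrd (e : Fin n → K) (x : AffineBuilding ν π n) (w : Fin n → K) : ℝ :=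
  x.coord.sum fun v t => t * relOrd π e v w

theorem chain_length_le (hπ : ν π = 1) {m : ℕ} {L : Fin (m + 1) → Lattice ν n}
    (hL : IsLatticeChain π L) : m + 1 ≤ n := by
  have h := Fintype.card_le_of_injective
    (fun i => (⟨relLength (L 0) (L i), hL.relLength_lt hπ i⟩ : Fin n))
    fun i j hij => (hL.relLength_strictMono hπ).injective (Fin.ext_iff.1 hij)
  simpa using h

theorem abs_realOrd_sub_le (hπ : ν π = 1) (he : e ≠ 0) {m : ℕ} {L : Fin (m + 1) → Lattice ν n}
    (hL : IsLatticeChain π L) {x y : AffineBuilding ν π n} (hx : x.LiesIn L) (hy : y.LiesIn L)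
    {w : Fin n → K} (hw : w ≠ 0) :
    |x.realOrd e w - y.realOrd e w| ≤ 2 * n * dist (chart L x) (chart L y) := by
  have hx1 := sum_coord_of_liesIn hπ hL hx
  have hy1 := sum_coord_of_liesIn hπ hL hy
  rw [realOrd, realOrd, sum_eq_of_liesIn hπ hL hx, sum_eq_of_liesIn hπ hL hy]
  set N : Fin (m + 1) → ℝ := fun i => relOrd π e (L i).cls w with hN
  have hN1 : ∀ i, |N i - N 0| ≤ 1 := fun i => by
    have := hL.abs_relOrd_sub_le hπ he hw i 0
    simp only [hN]
    exact_mod_cast this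
  -- Both coordinate sums are 1, so `N 0` may be subtracted. This removes the coordinate of `L 0`,
  -- which `abs_coord_sub_le` does not control, as `ω_0 = 0`.
  have h1 : ∑ i, x.coord (L i).cls * N i - ∑ i, y.coord (L i).cls * N i =
      ∑ i, (x.coord (L i).cls - y.coord (L i).cls) * (N i - N 0) := by
    simp only [sub_mul, mul_sub, Finset.sum_sub_distrib, ← Finset.sum_mul, hx1, hy1]
    ring
  change |∑ i, x.coord (L i).cls * N i - ∑ i, y.coord (L i).cls * N i| ≤ _
  rw [h1]
  have hb : ∀ i, |(x.coord (L i).cls - y.coord (L i).cls) * (N i - N 0)| ≤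
      2 * dist (chart L x) (chart L y) := by
    intro i
    rcases eq_or_ne i 0 with rfl | hi
    · simp [dist_nonneg]
    · rw [abs_mul]
      exact (mul_le_of_le_one_right (abs_nonneg _) (hN1 i)).trans
        (abs_coord_sub_le hπ hL i hi x y)
  refine (Finset.abs_sum_le_sum_abs _ _).trans ((Finset.sum_le_sum fun i _ => hb i).trans ?_)
  rw [Finset.sum_const, Finset.card_univ, Fintype.card_fin, nsmul_eq_mul]
  have hm : ((m + 1 : ℕ) : ℝ) ≤ n := by exact_mod_cast chain_length_le hπ hL
  have hd : (0 : ℝ) ≤ dist (chart L x) (chart L y) := dist_nonneg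
  nlinarith

theorem edist_eq (x y : AffineBuilding ν π n) : edist x y =
    ⨅ (k : ℕ) (p : ℕ → AffineBuilding ν π n) (_ : p 0 = x ∧ p k = y), pathLength k p :=
  rfl

theorem edist_realOrd_le (hπ : ν π = 1) (he : e ≠ 0) (x y : AffineBuilding ν π n)
    {w : Fin n → K} (hw : w ≠ 0) :
    edist (x.realOrd e w) (y.realOrd e w) ≤ (2 * n : ℝ≥0) * edist x y := by
  have hn : n ≠ 0 := by
    rintro rfl
    exact hw (Subsingleton.elim _ _)
  have hc : ((2 * n : ℝ≥0) : ℝ≥0∞) ≠ ⊤ := ENNReal.coe_ne_top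
  have hc0 : ((2 * n : ℝ≥0) : ℝ≥0∞) ≠ 0 := by simp [hn]
  have hs : ∀ x y : AffineBuilding ν π n,
      edist (x.realOrd e w) (y.realOrd e w) ≤ (2 * n : ℝ≥0) * simplexDist x y := by
    intro x y
    simp only [simplexDist, ENNReal.mul_iInf_of_ne hc0 hc]
    refine le_iInf fun m => le_iInf fun L => le_iInf fun h => ?_
    rw [edist_dist, edist_dist, ← ENNReal.ofReal_coe_nnreal,
      ← ENNReal.ofReal_mul (NNReal.coe_nonneg _)]
    refine ENNReal.ofReal_le_ofReal ?_
    rw [Real.dist_eq]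
    simpa using abs_realOrd_sub_le hπ he h.1 h.2.1 h.2.2 hw
  simp only [edist_eq, ENNReal.mul_iInf_of_ne hc0 hc]
  refine le_iInf fun k => le_iInf fun p => le_iInf fun h => ?_
  rw [← h.1, ← h.2, pathLength, Finset.mul_sum]
  exact (edist_le_range_sum_edist (fun i => (p i).realOrd e w) k).trans
    (Finset.sum_le_sum fun i _ => hs _ _)

theorem abs_realOrd_sub_relOrd_le (hπ : ν π = 1) (he : e ≠ 0) (x : AffineBuilding ν π n)
    {v : Vertex ν n} (hv : x.coord v ≠ 0) {w : Fin n → K} (hw : w ≠ 0) :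
    |x.realOrd e w - relOrd π e v w| ≤ 1 := by
  obtain ⟨m, L, hL, hx, -⟩ := x.exists_liesIn
  obtain ⟨j, rfl⟩ := hx v hv
  have hx1 := sum_coord_of_liesIn hπ hL hx
  rw [realOrd, sum_eq_of_liesIn hπ hL hx]
  have h1 : ∑ i, x.coord (L i).cls * (relOrd π e (L i).cls w : ℝ) - relOrd π e (L j).cls w =
      ∑ i, x.coord (L i).cls * ((relOrd π e (L i).cls w : ℝ) - relOrd π e (L j).cls w) := by
    simp only [mul_sub, Finset.sum_sub_distrib, ← Finset.sum_mul, hx1, one_mul]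
  rw [h1, ← hx1]
  refine (Finset.abs_sum_le_sum_abs _ _).trans (Finset.sum_le_sum fun i _ => ?_)
  rw [abs_mul, abs_of_nonneg (x.coord_nonneg _)]
  refine mul_le_of_le_one_right (x.coord_nonneg _) ?_
  exact_mod_cast hL.abs_relOrd_sub_le hπ he hw i j

/-- A vertex of the smallest simplex that contains a point. -/
theorem exists_coord_ne_zero (x : AffineBuilding ν π n) : ∃ v, x.coord v ≠ 0 := by
  obtain ⟨m, L, -, -, h⟩ := x.exists_liesIn
  exact ⟨_, h 0⟩

/-- A vertex of the smallest simplex that contains a point. -/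
def nearVertex (x : AffineBuilding ν π n) : Vertex ν n :=
  x.exists_coord_ne_zero.choose

theorem coord_nearVertex (x : AffineBuilding ν π n) : x.coord x.nearVertex ≠ 0 :=
  x.exists_coord_ne_zero.choose_spec

/-- In terms of the nearest vertices, the normalized orders vary coarsely Lipschitz. -/
theorem abs_relOrd_nearVertex_sub_le (hπ : ν π = 1) (he : e ≠ 0) {x y : AffineBuilding ν π n}
    {d : ℝ≥0} (h : edist x y ≤ d) {w : Fin n → K} (hw : w ≠ 0) :
    |relOrd π e x.nearVertex w - relOrd π e y.nearVertex w| ≤ (⌈2 * n * d⌉₊ + 2 : ℕ) := by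
  have h1 := abs_realOrd_sub_relOrd_le hπ he x x.coord_nearVertex hw
  have h2 := abs_realOrd_sub_relOrd_le hπ he y y.coord_nearVertex hw
  have h3 : |x.realOrd e w - y.realOrd e w| ≤ 2 * n * d := by
    have h4 := (edist_realOrd_le hπ he x y hw).trans (mul_le_mul_right h _)
    rw [edist_dist, Real.dist_eq, ← ENNReal.coe_mul, ← ENNReal.ofReal_coe_nnreal,
      ENNReal.ofReal_le_ofReal_iff (NNReal.coe_nonneg _)] at h4
    simpa using h4
  have h5 : (2 * n * d : ℝ) ≤ ⌈2 * n * d⌉₊ := by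
    have := Nat.le_ceil (2 * n * d)
    exact_mod_cast this
  have h6 : |(relOrd π e x.nearVertex w : ℝ) - relOrd π e y.nearVertex w| ≤
      (⌈2 * n * d⌉₊ : ℝ) + 2 := by
    rw [abs_le] at *
    constructor <;> linarith [h1.1, h1.2, h2.1, h2.2, h3.1, h3.2]
  exact_mod_cast h6

/-! ## Upper bounds for distances -/

theorem norm_alcoveVertex_le {k : ℕ} (hk : k ≤ n) : ‖alcoveVertex n k‖ ≤ n := by
  refine abs_le_of_sq_le_sq' ?_ (Nat.cast_nonneg n) |>.2
  rw [EuclideanSpace.norm_sq_eq]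
  have hb : ∀ j, ‖alcoveVertex n k j‖ ^ 2 ≤ 1 := by
    intro j
    rw [Real.norm_eq_abs, sq_abs, sq_le_one_iff_abs_le_one, abs_le]
    have h0 : (0 : ℝ) ≤ (k : ℝ) / n := by positivity
    have h1 : (k : ℝ) / n ≤ 1 := div_le_one_of_le₀ (by exact_mod_cast hk) (Nat.cast_nonneg n)
    simp only [alcoveVertex]
    split_ifs <;> constructor <;> linarith
  refine (Finset.sum_le_sum fun j _ => hb j).trans ?_
  simp only [Finset.sum_const, Finset.card_univ, Fintype.card_fin, nsmul_eq_mul, mul_one]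
  exact_mod_cast Nat.le_self_pow two_ne_zero n

theorem norm_chart_le (hπ : ν π = 1) {m : ℕ} {L : Fin (m + 1) → Lattice ν n}
    (hL : IsLatticeChain π L) {x : AffineBuilding ν π n} (hx : x.LiesIn L) :
    ‖chart L x‖ ≤ n := by
  rw [chart]
  refine (norm_sum_le _ _).trans ?_
  calc ∑ i, ‖x.coord (L i).cls • alcoveVertex n (relLength (L 0) (L i))‖
      ≤ ∑ i, x.coord (L i).cls * n := Finset.sum_le_sum fun i _ => by
        rw [norm_smul, Real.norm_eq_abs, abs_of_nonneg (x.coord_nonneg _)]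
        exact mul_le_mul_of_nonneg_left (norm_alcoveVertex_le (hL.relLength_lt hπ i).le)
          (x.coord_nonneg _)
    _ = n := by rw [← Finset.sum_mul, sum_coord_of_liesIn hπ hL hx, one_mul]

theorem edist_le_of_liesIn (hπ : ν π = 1) {m : ℕ} {L : Fin (m + 1) → Lattice ν n}
    (hL : IsLatticeChain π L) {x y : AffineBuilding ν π n} (hx : x.LiesIn L) (hy : y.LiesIn L) :
    edist x y ≤ (2 * n : ℝ≥0) := by
  rw [edist_eq]
  refine iInf_le_of_le 1 (iInf_le_of_le (fun i => if i = 0 then x else y)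
    (iInf_le_of_le ⟨by simp, by simp⟩ ?_))
  simp only [pathLength, Finset.range_one, Finset.sum_singleton]
  refine iInf_le_of_le m (iInf_le_of_le L (iInf_le_of_le ⟨hL, hx, hy⟩ ?_))
  rw [edist_dist, ← ENNReal.ofReal_coe_nnreal]
  refine ENNReal.ofReal_le_ofReal ((dist_le_norm_add_norm _ _).trans ?_)
  have := norm_chart_le hπ hL hx
  have := norm_chart_le hπ hL hy
  push_cast
  linarith

end AffineBuilding

/-! ### Vertices as points and the distances between them -/

theorem lt_inv_smul (hπ : ν π = 1) (hn : 0 < n) (L : Lattice ν n) : L.1 < π⁻¹ • L.1 := by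
  refine lt_of_le_of_ne (fun x hx => ?_) fun h => ?_
  · rw [mem_inv_smul_iff hπ]
    exact smul_mem_of_val_nonneg _ (by rw [hπ]; exact zero_le_one) hx
  · set w : Fin n → K := fun _ => 1
    have hw : w ≠ 0 := fun h => one_ne_zero (congrFun h ⟨0, hn⟩)
    have h1 := (zpow_smul_mem_iff hπ L hw (-ord π L w - 1)).not.2 (by lia)
    rw [h, mem_inv_smul_iff hπ] at h1
    refine h1 ?_
    have := zpow_smul_zpow_smul hπ 1 (-ord π L w - 1) w
    rw [zpow_one] at this
    rw [this, zpow_smul_mem_iff hπ L hw]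
    lia

namespace AffineBuilding

/-- A vertex as a point of the building. -/
def vertexPoint (hπ : ν π = 1) (hn : 0 < n) (v : Vertex ν n) : AffineBuilding ν π n where
  coord := Finsupp.single v 1
  coord_nonneg u := by
    classical
    rw [Finsupp.single_apply]
    split_ifs <;> norm_num
  sum_coord := by simp
  support_mem := by
    refine ⟨0, fun _ => v.out, ⟨fun i j hij => by lia, lt_inv_smul hπ hn _⟩, ?_⟩
    rw [Finsupp.support_single (hb := one_ne_zero)]
    simp [Lattice.cls]

theorem eq_of_vertexPoint_coord_ne_zero (hπ : ν π = 1) (hn : 0 < n) {v u : Vertex ν n}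
    (h : (vertexPoint hπ hn v).coord u ≠ 0) : v = u := by
  classical
  by_contra hne
  exact h (Finsupp.single_eq_of_ne' hne)

theorem nearVertex_vertexPoint (hπ : ν π = 1) (hn : 0 < n) (v : Vertex ν n) :
    (vertexPoint hπ hn v).nearVertex = v :=
  (eq_of_vertexPoint_coord_ne_zero hπ hn (coord_nearVertex _)).symm

theorem edist_nearVertex_le (hπ : ν π = 1) (hn : 0 < n) (x : AffineBuilding ν π n) :
    edist x (vertexPoint hπ hn x.nearVertex) ≤ (2 * n : ℝ≥0) := by
  obtain ⟨m, L, hL, hx, -⟩ := x.exists_liesIn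
  refine edist_le_of_liesIn hπ hL hx fun u hu => ?_
  rw [← eq_of_vertexPoint_coord_ne_zero hπ hn hu]
  exact hx _ x.coord_nearVertex

theorem edist_vertexPoint_le_of_adjacent (hπ : ν π = 1) (hn : 0 < n) {L M : Lattice ν n}
    (h1 : L.1 ≤ M.1) (h2 : M.1 ≤ π⁻¹ • L.1) :
    edist (vertexPoint hπ hn M.cls) (vertexPoint hπ hn L.cls) ≤ (2 * n : ℝ≥0) := by
  rcases h1.eq_or_lt with e1 | h1
  · rw [show L = M from Subtype.ext e1, edist_self]
    exact zero_le
  rcases h2.eq_or_lt with e2 | h2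
  · have : M = scale hπ (-1) L := Subtype.ext (by
      rw [e2]
      change _ = π ^ (-1 : ℤ) • _
      rw [zpow_neg_one])
    rw [this, cls_scale, edist_self]
    exact zero_le
  have hC : IsLatticeChain π ![L, M] := by
    refine ⟨?_, h2⟩
    rw [Fin.strictMono_iff_lt_succ]
    intro i
    fin_cases i
    exact h1
  refine edist_le_of_liesIn hπ hC (fun u hu => ⟨1, ?_⟩) fun u hu => ⟨0, ?_⟩
  · exact eq_of_vertexPoint_coord_ne_zero hπ hn hu
  · exact eq_of_vertexPoint_coord_ne_zero hπ hn hu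

/-- Insert `M + π L`: it is adjacent or equal to `L` up to homothety, and multiplication by `π ^ k`
already carries it into `M`, so the induction continues from it. -/
theorem edist_vertexPoint_le_of_le (hπ : ν π = 1) (hn : 0 < n) (k : ℕ) :
    ∀ L M : Lattice ν n, M.1 ≤ L.1 → (scale hπ k L).1 ≤ M.1 →
      edist (vertexPoint hπ hn L.cls) (vertexPoint hπ hn M.cls) ≤ (k * (2 * n) : ℝ≥0) := by
  induction k with
  | zero =>
    intro L M h1 h2
    have : L = M := Subtype.ext (le_antisymm (fun x hx => h2 (by
      rw [mem_scale]
      simpa using hx)) h1)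
    simp [this]
  | succ k ih =>
    intro L M h1 h2
    have hM' : Submodule.IsLattice K (M.1 ⊔ (scale hπ 1 L).1) := by
      have := M.2
      have := (scale hπ 1 L).2
      infer_instance
    have hL1 : (scale hπ 1 L).1 ≤ L.1 := fun x hx => by
      rw [mem_scale] at hx
      have := zpow_smul_mem_mono hπ L.1 (show (-1 : ℤ) ≤ 0 by lia) hx
      simpa using this
    have a := edist_vertexPoint_le_of_adjacent hπ hn (L := ⟨_, hM'⟩) (M := L) (sup_le h1 hL1)
      fun x hx => by
        rw [mem_inv_smul_iff hπ]
        refine Submodule.mem_sup_right ?_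
        rw [mem_scale]
        have := zpow_smul_zpow_smul hπ (-1) 1 x
        rw [zpow_one] at this
        rw [this]
        simpa using hx
    have b := ih ⟨_, hM'⟩ M le_sup_left fun x hx => by
      rw [mem_scale] at hx
      obtain ⟨y, hy, z, hz, hyz⟩ := Submodule.mem_sup.1 hx
      have hx' : x = π ^ (k : ℤ) • y + π ^ (k : ℤ) • z := by
        rw [← smul_add, hyz, zpow_smul_zpow_smul hπ]
        simp
      rw [hx']
      refine M.1.add_mem ?_ (h2 ?_)
      · refine smul_mem_of_val_nonneg _ ?_ hy
        rw [val_zpow hπ]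
        exact_mod_cast Int.natCast_nonneg k
      · rw [mem_scale] at hz ⊢
        rw [zpow_smul_zpow_smul hπ]
        convert hz using 3
        push_cast
        ring
    refine (edist_triangle _ _ _).trans ((add_le_add a b).trans_eq ?_)
    rw [← ENNReal.coe_add]
    congr 1
    push_cast
    ring

theorem edist_vertexPoint_le (hπ : ν π = 1) (hn : 0 < n) (k : ℕ) {L M : Lattice ν n}
    (h1 : (scale hπ k L).1 ≤ M.1) (h2 : (scale hπ k M).1 ≤ L.1) :
    edist (vertexPoint hπ hn L.cls) (vertexPoint hπ hn M.cls) ≤ (2 * k * (2 * n) : ℝ≥0) := by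
  -- Replacing `M` by `π ^ k M` in its class produces the nested situation `π ^ (2 k) L ⊆ π ^ k M ⊆
  -- L`.
  rw [← cls_scale hπ k M]
  have := edist_vertexPoint_le_of_le hπ hn (2 * k) L (scale hπ k M) h2 fun x hx => by
    rw [mem_scale] at hx ⊢
    refine h1 ?_
    rw [mem_scale, zpow_smul_zpow_smul hπ]
    convert hx using 3
    push_cast
    ring
  exact_mod_cast this

end AffineBuilding

/-! ## The type of a lattice along the standard flag -/

/-- The intersection of a lattice with the span of the standard basis vectors up to index `i`. -/
def flagPart (L : Lattice ν n) (i : Fin n) : Submodule (ringOfIntegers ν) (Fin n → K) where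
  carrier := {x | x ∈ L.1 ∧ ∀ j, i < j → x j = 0}
  add_mem' hx hy := ⟨L.1.add_mem hx.1 hy.1, fun j hj => by
    rw [Pi.add_apply, hx.2 j hj, hy.2 j hj, add_zero]⟩
  zero_mem' := ⟨L.1.zero_mem, fun _ _ => rfl⟩
  smul_mem' c x hx := ⟨L.1.smul_mem c hx.1, fun j hj => by
    change (c : K) * x j = 0
    rw [hx.2 j hj, mul_zero]⟩

theorem exists_lead (hπ : ν π = 1) (L : Lattice ν n) (i : Fin n) :
    ∃ a : ℤ, (∃ f ∈ flagPart L i, f i = π ^ a) ∧ ∀ x ∈ flagPart L i, (a : WithTop ℤ) ≤ ν (x i) := by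
  obtain ⟨N, hN⟩ := exists_val_lower_bound L
  obtain ⟨k, hk⟩ := exists_zpow_smul_mem hπ L (Pi.single i 1)
  obtain ⟨a, ⟨f, hf, hfa⟩, hmin⟩ := Int.exists_least_of_bdd
    (P := fun a : ℤ => ∃ f ∈ flagPart L i, ν (f i) = a)
    ⟨N, fun z ⟨f, hf, hz⟩ => by
      have := hN f hf.1 i
      rw [hz] at this
      exact_mod_cast this⟩
    ⟨k, π ^ k • Pi.single i 1, ⟨hk, fun j hj => by simp [hj.ne']⟩, by simp [val_zpow hπ]⟩
  have hfi : f i ≠ 0 := by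
    intro h
    rw [h] at hfa
    simp at hfa
  have hval : ν (π ^ a * (f i)⁻¹) = 0 := by
    rw [ν.map_mul, val_zpow hπ, val_inv_of_eq hfa]
    norm_cast
    lia
  refine ⟨a, ⟨(π ^ a * (f i)⁻¹) • f, smul_mem_of_val_nonneg _ hval.ge hf, ?_⟩, fun x hx => ?_⟩
  · rw [Pi.smul_apply, smul_eq_mul, mul_assoc, inv_mul_cancel₀ hfi, mul_one]
  · rcases eq_or_ne (x i) 0 with h | h
    · simp [h]
    · obtain ⟨b, hb⟩ := exists_val_eq (ν := ν) h
      rw [hb]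
      exact_mod_cast hmin b ⟨x, hx, hb⟩

/-- The smallest valuation of the `i`-th coordinate of a vector in `flagPart L i`. -/
def lead (hπ : ν π = 1) (L : Lattice ν n) (i : Fin n) : ℤ :=
  (exists_lead hπ L i).choose

theorem exists_eq_zpow_lead (hπ : ν π = 1) (L : Lattice ν n) (i : Fin n) :
    ∃ f ∈ flagPart L i, f i = π ^ lead hπ L i :=
  (exists_lead hπ L i).choose_spec.1

theorem lead_le (hπ : ν π = 1) {L : Lattice ν n} {i : Fin n} {x : Fin n → K}
    (hx : x ∈ flagPart L i) : (lead hπ L i : WithTop ℤ) ≤ ν (x i) :=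
  (exists_lead hπ L i).choose_spec.2 x hx

theorem lead_le_add (hπ : ν π = 1) {k : ℤ} {L M : Lattice ν n} (h : (scale hπ k L).1 ≤ M.1)
    (i : Fin n) : lead hπ M i ≤ lead hπ L i + k := by
  obtain ⟨f, hf, hfi⟩ := exists_eq_zpow_lead hπ L i
  have hm : π ^ k • f ∈ flagPart M i := ⟨h (by
    rw [mem_scale, zpow_smul_zpow_smul hπ]
    simpa using hf.1), fun j hj => by simp [hf.2 j hj]⟩
  have := lead_le hπ hm
  rw [Pi.smul_apply, hfi, smul_eq_mul, ν.map_mul, val_zpow hπ, val_zpow hπ] at this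
  norm_cast at this
  lia

/-- The first flag part is `L ∩ K e₀`. Hence normalizing by the order of `e₀` makes the first
exponent 0. -/
theorem lead_zero (hπ : ν π = 1) (hn : 0 < n) (L : Lattice ν n) :
    lead hπ L ⟨0, hn⟩ = -ord π L (Pi.single ⟨0, hn⟩ 1) := by
  set z : Fin n := ⟨0, hn⟩ with hz
  have he : (Pi.single z 1 : Fin n → K) ≠ 0 := by simp
  apply le_antisymm
  · have hm : π ^ (-ord π L (Pi.single z 1)) • Pi.single z 1 ∈ flagPart L z :=
      ⟨(zpow_smul_mem_iff hπ L he _).2 le_rfl, fun j hj => by simp [hj.ne']⟩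
    have := lead_le hπ hm
    simp only [Pi.smul_apply, Pi.single_eq_same, smul_eq_mul, mul_one, val_zpow hπ] at this
    exact_mod_cast this
  · obtain ⟨f, hf, hfz⟩ := exists_eq_zpow_lead hπ L z
    rw [← zpow_smul_mem_iff hπ L he]
    convert hf.1 using 1
    ext j
    rcases eq_or_ne j z with rfl | hj
    · simp [hfz]
    · have : z < j := lt_of_le_of_ne (Fin.le_def.2 (Nat.zero_le _)) hj.symm
      simp [hj, hf.2 j this]

/-! ## The hull of a lattice -/

/-- Stretching a lattice along the standard flag to the exponents `c`: for rapidly increasing `c`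
the result only depends on the lattice up to bounded perturbations. -/
def hull (hπ : ν π = 1) (c : Fin n → ℤ) (L : Lattice ν n) :
    Submodule (ringOfIntegers ν) (Fin n → K) :=
  ⨆ i, π ^ (c i - lead hπ L i) • flagPart L i

theorem mem_hull (hπ : ν π = 1) {c : Fin n → ℤ} {L : Lattice ν n} {i : Fin n} {k : ℤ}
    (hk : c i - lead hπ L i ≤ k) {x : Fin n → K} (hx : x ∈ flagPart L i) :
    π ^ k • x ∈ hull hπ c L := by
  refine (le_iSup (fun i => π ^ (c i - lead hπ L i) • flagPart L i) i :) ?_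
  rw [mem_zpow_smul_iff hπ, zpow_smul_zpow_smul hπ]
  refine smul_mem_of_val_nonneg _ ?_ hx
  rw [val_zpow hπ]
  norm_cast
  lia

/-- Subtract from a vector of `flagPart M i` the multiple of a leading vector `f` of `L` with the
same `i`-th coordinate. The multiple of `f` is absorbed by the `i`-th part of the hull of `L`. The
remainder lies one step lower in the flag and, after multiplication by `π ^ k`, in `L`; the growth
condition `hc` is what lets the preceding part absorb it. -/
theorem hull_le (hπ : ν π = 1) {c : Fin n → ℤ} {L M : Lattice ν n} {k : ℤ}
    (h : (scale hπ k M).1 ≤ L.1)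
    (hc : ∀ i j : Fin n, (i : ℕ) + 1 = j → c i - lead hπ L i + k ≤ c j - lead hπ M j) :
    hull hπ c M ≤ hull hπ c L := by
  refine iSup_le fun i x hx => ?_
  rw [mem_zpow_smul_iff hπ] at hx
  set y := π ^ (-(c i - lead hπ M i)) • x with hy
  have hxy : x = π ^ (c i - lead hπ M i) • y := by
    rw [hy, zpow_smul_zpow_smul hπ]
    simp
  obtain ⟨f, hf, hfi⟩ := exists_eq_zpow_lead hπ L i
  have hlead := lead_le_add hπ h i
  have hy1 := lead_le hπ hx
  set u := y i * π ^ (-lead hπ L i) with hu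
  have huv : ((lead hπ M i - lead hπ L i : ℤ) : WithTop ℤ) ≤ ν u := by
    rw [hu, ν.map_mul, val_zpow hπ, sub_eq_add_neg, WithTop.coe_add]
    exact add_le_add_left hy1 _
  have hsplit : x = π ^ (c i - lead hπ M i) • u • f + π ^ (c i - lead hπ M i) • (y - u • f) := by
    rw [← smul_add, hxy]
    congr 1
    abel
  have hpi := uniformizer_ne_zero hπ
  rw [hsplit]
  refine Submodule.add_mem _ ?_ ?_
  · have h1 := mem_hull hπ (le_refl (c i - lead hπ L i)) hf
    rw [smul_smul]
    refine smul_mem_of_val_le _ (zpow_ne_zero _ hpi) ?_ h1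
    rw [ν.map_mul, val_zpow hπ, val_zpow hπ]
    refine le_trans ?_ (add_le_add_right huv _)
    norm_cast
    lia
  · have hz : ∀ j, i ≤ j → (y - u • f) j = 0 := by
      intro j hj
      rcases hj.eq_or_lt with rfl | hj
      · simp only [Pi.sub_apply, Pi.smul_apply, smul_eq_mul, hfi, hu]
        rw [mul_assoc, ← zpow_add₀ hpi]
        simp
      · simp [hx.2 j hj, hf.2 j hj]
    have hmem : π ^ k • (y - u • f) ∈ L.1 := by
      rw [smul_sub]
      refine L.1.sub_mem (h ?_) ?_
      · rw [mem_scale, zpow_smul_zpow_smul hπ]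
        simpa using hx.1
      · rw [smul_smul]
        refine smul_mem_of_val_nonneg _ ?_ hf.1
        rw [ν.map_mul, val_zpow hπ]
        refine le_trans ?_ (add_le_add_right huv _)
        norm_cast
        lia
    rcases Nat.eq_zero_or_pos (i : ℕ) with hi | hi
    · have : y - u • f = 0 := by
        ext j
        exact hz j (Fin.le_def.2 (by lia))
      rw [this, smul_zero]
      exact Submodule.zero_mem _
    · let j : Fin n := ⟨i - 1, by lia⟩
      have hj : (j : ℕ) + 1 = i := Nat.sub_add_cancel hi
      have hp : π ^ k • (y - u • f) ∈ flagPart L j :=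
        ⟨hmem, fun l hl => by
          rw [Pi.smul_apply, hz l (Fin.le_def.2 (by
            have : (j : ℕ) < l := hl
            lia)), smul_zero]⟩
      have := hc j i hj
      have h2 := mem_hull hπ (c := c) (k := c i - lead hπ M i - k) (by lia) hp
      rw [zpow_smul_zpow_smul hπ] at h2
      simpa using h2

theorem hull_le_scale (hπ : ν π = 1) {c : Fin n → ℤ} {L : Lattice ν n} {r : ℤ}
    (h : ∀ i, r ≤ c i - lead hπ L i) : hull hπ c L ≤ (scale hπ r L).1 := by
  refine iSup_le fun i x hx => ?_
  rw [mem_zpow_smul_iff hπ] at hx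
  rw [mem_scale]
  exact zpow_smul_mem_mono hπ L.1 (by linarith [h i]) hx.1

theorem scale_le_hull (hπ : ν π = 1) (hn : 0 < n) {c : Fin n → ℤ} {L : Lattice ν n} {q : ℤ}
    (h : ∀ i, c i - lead hπ L i ≤ q) : (scale hπ q L).1 ≤ hull hπ c L := by
  intro x hx
  rw [mem_scale] at hx
  have hl : π ^ (-q) • x ∈ flagPart L ⟨n - 1, by lia⟩ :=
    ⟨hx, fun j hj => absurd (Fin.lt_def.1 hj) (by simp only; lia)⟩
  have := mem_hull hπ (h _) hl
  rw [zpow_smul_zpow_smul hπ] at this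
  simpa using this

/-- The hull is squeezed between two multiples of the lattice: `π ^ q L ⊆ hull L = hull M ⊆ π ^ (-r)
M`. -/
theorem scale_le_of_hull_eq (hπ : ν π = 1) (hn : 0 < n) {c : Fin n → ℤ} {L M : Lattice ν n}
    {q r : ℤ} (hL : ∀ i, c i - lead hπ L i ≤ q) (hM : ∀ i, -r ≤ c i - lead hπ M i)
    (h : hull hπ c L = hull hπ c M) : (scale hπ (q + r) L).1 ≤ M.1 := by
  intro x hx
  have h1 : π ^ (-r) • x ∈ (scale hπ q L).1 := by
    rw [mem_scale, zpow_smul_zpow_smul hπ] at *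
    convert hx using 3
    ring
  have h2 := hull_le_scale hπ hM (h ▸ scale_le_hull hπ hn hL h1)
  rw [mem_scale, zpow_smul_zpow_smul hπ] at h2
  simpa using h2

/-! ## Normalized representatives -/

/-- The lattice `L` in the class `v` with `e₀ ∈ L`, `π⁻¹ e₀ ∉ L`. -/
def normalized (hπ : ν π = 1) (hn : 0 < n) (v : Vertex ν n) : Lattice ν n :=
  scale hπ (ord π v.out (Pi.single ⟨0, hn⟩ 1)) v.out

theorem cls_normalized (hπ : ν π = 1) (hn : 0 < n) (v : Vertex ν n) :
    (normalized hπ hn v).cls = v := by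
  rw [normalized, cls_scale]
  exact Quotient.out_eq v

theorem ord_normalized (hπ : ν π = 1) (hn : 0 < n) (v : Vertex ν n) {w : Fin n → K}
    (hw : w ≠ 0) : ord π (normalized hπ hn v) w = relOrd π (Pi.single ⟨0, hn⟩ 1) v w :=
  ord_scale hπ _ _ hw

theorem lead_normalized_zero (hπ : ν π = 1) (hn : 0 < n) (v : Vertex ν n) :
    lead hπ (normalized hπ hn v) ⟨0, hn⟩ = 0 := by
  rw [lead_zero, ord_normalized hπ hn v (by simp), relOrd]
  simp

theorem scale_normalized_le (hπ : ν π = 1) (hn : 0 < n) {u v : Vertex ν n} {D : ℤ}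
    (h : ∀ w : Fin n → K, w ≠ 0 →
      |relOrd π (Pi.single ⟨0, hn⟩ 1) u w - relOrd π (Pi.single ⟨0, hn⟩ 1) v w| ≤ D) :
    (scale hπ D (normalized hπ hn u)).1 ≤ (normalized hπ hn v).1 := by
  intro x hx
  rcases eq_or_ne x 0 with rfl | hx0
  · exact Submodule.zero_mem _
  rw [mem_scale, zpow_smul_mem_iff hπ _ hx0, ord_normalized hπ hn u hx0] at hx
  rw [mem_iff_ord_nonneg hπ _ hx0, ord_normalized hπ hn v hx0]
  have := (abs_le.1 (h x hx0)).2
  lia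

/-! ## The standard apartment -/

/-- The submodule of the vectors with `i`-th coordinate in `π ^ a i 𝒪`. -/
def diagSubmodule (ν : AddValuation K (WithTop ℤ)) (a : Fin n → ℤ) :
    Submodule (ringOfIntegers ν) (Fin n → K) where
  carrier := {x | ∀ i, (a i : WithTop ℤ) ≤ ν (x i)}
  add_mem' hx hy i := ν.map_le_add (hx i) (hy i)
  zero_mem' i := by simp
  smul_mem' c x hx i := by
    have hc : 0 ≤ ν (c : K) := c.2
    change _ ≤ ν ((c : K) * x i)
    rw [ν.map_mul]
    exact le_add_of_nonneg_of_le hc (hx i)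

theorem zpow_smul_single_mem_diagSubmodule (hπ : ν π = 1) (a : Fin n → ℤ) (i : Fin n) (k : ℤ) :
    π ^ k • (Pi.single i 1 : Fin n → K) ∈ diagSubmodule ν a ↔ a i ≤ k := by
  constructor
  · intro h
    have := h i
    simp only [Pi.smul_apply, Pi.single_eq_same, smul_eq_mul, mul_one, val_zpow hπ] at this
    exact_mod_cast this
  · intro h j
    rcases eq_or_ne j i with rfl | hj
    · simp only [Pi.smul_apply, Pi.single_eq_same, smul_eq_mul, mul_one, val_zpow hπ]
      exact_mod_cast h
    · simp [hj]

theorem isLattice_diagSubmodule (hπ : ν π = 1) (a : Fin n → ℤ) :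
    Submodule.IsLattice K (diagSubmodule ν a) where
  fg := by
    have hs : diagSubmodule ν a = Submodule.span (ringOfIntegers ν)
        (Set.range fun i => π ^ a i • (Pi.single i 1 : Fin n → K)) := by
      apply le_antisymm
      · intro x hx
        have h0 : ∀ i, 0 ≤ ν (x i * π ^ (-a i)) := by
          intro i
          have := hx i
          rw [ν.map_mul, val_zpow hπ]
          generalize ν (x i) = t at *
          induction t using WithTop.recTopCoe with
          | top => simp
          | coe t =>
            norm_cast at *
            lia
        have hx' : x = ∑ i, (⟨x i * π ^ (-a i), h0 i⟩ : ringOfIntegers ν) •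
            (π ^ a i • (Pi.single i 1 : Fin n → K)) := by
          conv_lhs => rw [← Finset.univ_sum_single x]
          refine Finset.sum_congr rfl fun i _ => ?_
          change _ = (x i * π ^ (-a i)) • (π ^ a i • (Pi.single i 1 : Fin n → K))
          rw [smul_smul, mul_assoc, ← zpow_add₀ (uniformizer_ne_zero hπ), neg_add_cancel,
            zpow_zero, mul_one, ← Pi.single_smul, smul_eq_mul, mul_one]
        rw [hx']
        exact Submodule.sum_mem _ fun i _ => Submodule.smul_mem _ _ (Submodule.subset_span ⟨i, rfl⟩)
      · rw [Submodule.span_le]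
        rintro _ ⟨i, rfl⟩
        exact (zpow_smul_single_mem_diagSubmodule hπ a i _).2 le_rfl
    rw [hs]
    exact Submodule.fg_span (Set.finite_range _)
  span_eq_top := by
    rw [eq_top_iff, ← (Pi.basisFun K (Fin n)).span_eq, Submodule.span_le]
    rintro _ ⟨i, rfl⟩
    have h := Submodule.subset_span (R := K)
      ((zpow_smul_single_mem_diagSubmodule hπ a i (a i)).2 le_rfl)
    have h' := Submodule.smul_mem _ (π ^ a i)⁻¹ h
    rw [inv_smul_smul₀ (zpow_ne_zero _ (uniformizer_ne_zero hπ))] at h'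
    simpa using h'

/-- The lattice of the vectors with `i`-th coordinate in `π ^ a i 𝒪`. -/
def diagLattice (hπ : ν π = 1) (a : Fin n → ℤ) : Lattice ν n :=
  ⟨diagSubmodule ν a, isLattice_diagSubmodule hπ a⟩

theorem ord_diagLattice_single (hπ : ν π = 1) (a : Fin n → ℤ) (i : Fin n) :
    ord π (diagLattice hπ a) (Pi.single i 1) = -a i :=
  ord_eq_of_forall hπ _ (by simp) fun k => by
    rw [neg_neg]
    exact zpow_smul_single_mem_diagSubmodule hπ a i k

theorem scale_diagLattice_le (hπ : ν π = 1) {a b : Fin n → ℤ} {k : ℤ} (h : ∀ i, b i ≤ a i + k) :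
    (scale hπ k (diagLattice hπ a)).1 ≤ (diagLattice hπ b).1 := by
  intro x hx i
  rw [mem_scale] at hx
  have h1 := hx i
  rw [Pi.smul_apply, smul_eq_mul, ν.map_mul, val_zpow hπ] at h1
  have h2 := h i
  generalize ν (x i) = t at *
  induction t using WithTop.recTopCoe with
  | top => simp
  | coe t =>
    norm_cast at *
    lia

namespace AffineBuilding

theorem le_of_asdimLE_succ (hπ : ν π = 1) {m k : ℕ} (h : AsdimLE (AffineBuilding ν π (m + 1)) k) :
    m ≤ k := by
  have hn : 0 < m + 1 := Nat.succ_pos m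
  -- The exponent 0 at `e₀` fixes the representative in the homothety class, so normalized orders of
  -- the other basis vectors are `-y i`.
  let L : (Fin m → ℤ) → Lattice ν (m + 1) := fun y => diagLattice hπ (Fin.cons 0 y)
  refine le_of_asdimLE (fun y => vertexPoint hπ hn (L y).cls)
    (2 * (1 : ℕ) * (2 * (m + 1 : ℕ))) (fun y y' hy => ?_) (fun R => ?_) h
  · have hL : ∀ y y' : Fin m → ℤ, (∀ i, |y i - y' i| ≤ 1) →
        (scale hπ ((1 : ℕ) : ℤ) (L y)).1 ≤ (L y').1 := by
      intro y y' hy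
      refine scale_diagLattice_le hπ fun i => ?_
      refine Fin.cases ?_ (fun j => ?_) i
      · simp
      · have := abs_le.1 (hy j)
        simp only [Fin.cons_succ, Nat.cast_one]
        lia
    exact edist_vertexPoint_le hπ hn 1 (hL y y' hy)
      (hL y' y fun i => by rw [abs_sub_comm]; exact hy i)
  · refine ⟨(⌈2 * (m + 1 : ℕ) * R⌉₊ + 2 : ℕ), fun y y' hyy' i => ?_⟩
    have he : (Pi.single 0 1 : Fin (m + 1) → K) ≠ 0 := by simp
    have hw : (Pi.single i.succ 1 : Fin (m + 1) → K) ≠ 0 := by simp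
    have := abs_relOrd_nearVertex_sub_le hπ he hyy' hw
    rw [nearVertex_vertexPoint, nearVertex_vertexPoint, relOrd_cls hπ he _ hw,
      relOrd_cls hπ he _ hw, ord_diagLattice_single, ord_diagLattice_single,
      ord_diagLattice_single, ord_diagLattice_single, abs_sub_comm] at this
    simpa [neg_add_eq_sub] using this

/-! ## The upper bound -/

theorem asdimLE (hπ : ν π = 1) (hn : 0 < n) : AsdimLE (AffineBuilding ν π n) (n - 1) := by
  intro d hd
  set z : Fin n := ⟨0, hn⟩ with hz
  have he : (Pi.single z 1 : Fin n → K) ≠ 0 := by simp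
  -- The variation of normalized orders over distance `2 * d`, the most that two points of a ball of
  -- radius `d` can be apart; 2 pays for passing to near vertices.
  set D : ℤ := ((⌈2 * n * (2 * d)⌉₊ + 2 : ℕ) : ℤ) with hDdef
  have hD0 : 0 < D := by positivity
  let A : AffineBuilding ν π n → Lattice ν n := fun x => normalized hπ hn x.nearVertex
  have hA : ∀ x y, edist x y ≤ (2 * d : ℝ≥0) → (scale hπ D (A x)).1 ≤ (A y).1 := fun x y hxy =>
    scale_normalized_le hπ hn fun w hw => abs_relOrd_nearVertex_sub_le hπ he hxy hw
  let a : AffineBuilding ν π n → Fin n → ℤ := fun x => lead hπ (A x)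
  have haz : ∀ x, a x z = 0 := fun x => lead_normalized_zero hπ hn _
  have ha : ∀ x y, edist x y ≤ (2 * d : ℝ≥0) → ∀ i, |a x i - a y i| ≤ D := fun x y hxy i => by
    have h1 := lead_le_add hπ (hA x y hxy) i
    have h2 := lead_le_add hπ (hA y x (by rwa [edist_comm])) i
    rw [abs_le]
    constructor <;> simp only [a] <;> lia
  -- The period leaves room for `n` disjoint gaps of length `D`, one for each color.
  set P : ℤ := n * D with hP
  have hP0 : 0 < P := mul_pos (by exact_mod_cast hn) hD0
  let Good : Fin n → AffineBuilding ν π n → Prop := fun c x =>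
    ∀ j ≠ z, (a x j - ((c : ℕ) + 1) * D) % P < P - D
  -- The lower corner of the box of color `c` containing the exponents of `x`; index `z` is the one
  -- normalized to 0.
  let B : Fin n → AffineBuilding ν π n → Fin n → ℤ := fun c x j =>
    if j = z then 0 else P * ((a x j - ((c : ℕ) + 1) * D) / P) + ((c : ℕ) + 1) * D
  have hB : ∀ c x i, |a x i - B c x i| ≤ P := by
    intro c x i
    simp only [B]
    split_ifs with hi
    · rw [hi, haz]
      simpa using hP0.le
    · have h1 := Int.emod_add_mul_ediv (a x i - ((c : ℕ) + 1) * D) P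
      have h2 := Int.emod_nonneg (a x i - ((c : ℕ) + 1) * D) hP0.ne'
      have h3 := Int.emod_lt_of_pos (a x i - ((c : ℕ) + 1) * D) hP0
      rw [abs_le]
      constructor <;> linarith
  -- Hull exponents that depend only on the box. The slope pays for an error `P` between exponent
  -- and corner at each of two consecutive indices, and for the shift `D` in `hull_le`.
  let C : Fin n → AffineBuilding ν π n → Fin n → ℤ := fun c x i => (2 * P + D) * (i : ℕ) + B c x i
  have hCl : ∀ c x y, B c x = B c y → ∀ i, -P ≤ C c x i - a y i := by
    intro c x y hxy i
    have h1 := abs_le.1 (hB c y i)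
    have h2 : 0 ≤ (2 * P + D) * ((i : ℕ) : ℤ) := by positivity
    simp only [C, hxy]
    linarith
  have hCu : ∀ c x y, B c x = B c y → ∀ i, C c x i - a y i ≤ (2 * P + D) * n + P := by
    intro c x y hxy i
    have h1 := abs_le.1 (hB c y i)
    have h2 : (2 * P + D) * ((i : ℕ) : ℤ) ≤ (2 * P + D) * n :=
      mul_le_mul_of_nonneg_left (by exact_mod_cast i.2.le) (by positivity)
    simp only [C, hxy]
    linarith
  let H : Fin n → AffineBuilding ν π n → Submodule (ringOfIntegers ν) (Fin n → K) := fun c x =>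
    hull hπ (C c x) (A x)
  have hkey : ∀ c x y, Good c x → Good c y → edist x y ≤ (2 * d : ℝ≥0) →
      B c x = B c y ∧ H c x = H c y := by
    intro c x y hx hy hxy
    have hBxy : ∀ x y, Good c x → Good c y → edist x y ≤ (2 * d : ℝ≥0) → B c x = B c y := by
      intro x y hx hy hxy
      funext j
      simp only [B]
      split_ifs with hj
      · rfl
      · rw [ediv_eq_of_emod_lt hP0 (hx j hj) (hy j hj)]
        have := ha x y hxy j
        convert this using 2
        ring
    have hle : ∀ x y, Good c x → Good c y → edist x y ≤ (2 * d : ℝ≥0) → H c y ≤ H c x := by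
      intro x y hx hy hxy
      have hb := hBxy x y hx hy hxy
      have hc : C c y = C c x := by simp only [C, hb]
      simp only [H, hc]
      refine hull_le hπ (hA y x (by rwa [edist_comm])) fun i j hij => ?_
      have h1 := abs_le.1 (hB c x i)
      have h2 := abs_le.1 (hB c y j)
      have h3 : ((j : ℕ) : ℤ) = (i : ℕ) + 1 := by exact_mod_cast hij.symm
      change C c x i - a x i + D ≤ C c x j - a y j
      simp only [C, h3, hb] at h1 ⊢
      linarith
    exact ⟨hBxy x y hx hy hxy, le_antisymm (hle y x hy hx (by rwa [edist_comm]))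
      (hle x y hx hy hxy)⟩
  -- One member of the cover for each color, box and hull.
  let piece : Fin n → AffineBuilding ν π n → Set (AffineBuilding ν π n) := fun c y =>
    {x | Good c x ∧ B c x = B c y ∧ H c x = H c y}
  have hpiece : ∀ c x y, x ∈ piece c y → piece c y = piece c x := by
    rintro c x y ⟨-, h1, h2⟩
    simp only [piece, h1, h2]
  -- The sum `q + r` of the constants for `scale_le_of_hull_eq`: the upper bound from `hCu` and the
  -- `P` from `hCl`.
  set k : ℕ := ((2 * P + D) * n + P + P).toNat with hk
  have hk' : (k : ℤ) = (2 * P + D) * n + P + P := Int.toNat_of_nonneg (by positivity)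
  refine ⟨{S | ∃ c y, S = piece c y}, ?_, ⟨2 * n + 2 * k * (2 * n) + 2 * n, ?_⟩, fun x => ?_⟩
  · refine Set.eq_univ_of_forall fun x => ?_
    obtain ⟨c, hc⟩ := exists_color z (a x) hD0
    exact ⟨_, ⟨c, x, rfl⟩, hc, rfl, rfl⟩
  · rintro _ ⟨c, y₀, rfl⟩ x ⟨-, hx1, hx2⟩ y ⟨-, hy1, hy2⟩
    have hle : ∀ x y, B c x = B c y → H c x = H c y → (scale hπ k (A x)).1 ≤ (A y).1 := by
      intro x y h1 h2
      rw [hk']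
      refine scale_le_of_hull_eq hπ hn (hCu c x x rfl) (hCl c x y h1) ?_
      have hc : C c x = C c y := by simp only [C, h1]
      have h3 : hull hπ (C c x) (A x) = hull hπ (C c y) (A y) := h2
      rw [h3, hc]
    have h1 : B c x = B c y := hx1.trans hy1.symm
    have h2 : H c x = H c y := hx2.trans hy2.symm
    have hv := edist_vertexPoint_le hπ hn k (hle x y h1 h2) (hle y x h1.symm h2.symm)
    simp only [A, cls_normalized] at hv
    refine (edist_triangle4 x (vertexPoint hπ hn x.nearVertex)
      (vertexPoint hπ hn y.nearVertex) y).trans ?_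
    have hy' := edist_nearVertex_le hπ hn y
    rw [edist_comm] at hy'
    push_cast at hv hy' ⊢
    have hx' := edist_nearVertex_le hπ hn x
    push_cast at hx'
    exact add_le_add (add_le_add hx' hv) hy'
  · classical
    -- For each color at most one piece meets the ball: good points of one color in it are at most
    -- `2 * d` apart, so by `hkey` they share box and hull.
    let g : Fin n → Set (AffineBuilding ν π n) := fun c =>
      if h : ∃ y, Good c y ∧ edist y x < d then piece c h.choose else ∅
    have hsub : {S ∈ {S | ∃ c y, S = piece c y} | ∃ y ∈ S, edist y x < d} ⊆ Set.range g := by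
      rintro _ ⟨⟨c, y₀, rfl⟩, y, hy, hyx⟩
      refine ⟨c, ?_⟩
      have hex : ∃ y, Good c y ∧ edist y x < d := ⟨y, hy.1, hyx⟩
      simp only [g, dif_pos hex]
      obtain ⟨h1, h2⟩ := hex.choose_spec
      have hd2 : edist hex.choose y ≤ (2 * d : ℝ≥0) := by
        refine (edist_triangle_right _ _ x).trans ?_
        rw [two_mul, ENNReal.coe_add]
        exact add_le_add h2.le hyx.le
      obtain ⟨h3, h4⟩ := hkey c _ _ h1 hy.1 hd2
      rw [hpiece c y y₀ hy]
      exact (hpiece c _ y ⟨h1, h3, h4⟩).symm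
    refine (Set.encard_le_encard hsub).trans ?_
    rw [← Set.image_univ]
    refine (Set.encard_image_le _ _).trans ?_
    rw [Set.encard_univ, ENat.card_eq_coe_fintype_card, Fintype.card_fin]
    have : n ≤ n - 1 + 1 := by lia
    exact_mod_cast this

end AffineBuilding

end BruhatTits
end

/-! ### The asymptotic dimension of the building -/

theorem mainTheorem3 {K : Type*} [Field K] (ν : AddValuation K (WithTop ℤ))
    (π : K) (hπ : ν π = 1) (n : ℕ) (hn : 1 ≤ n) :
    asdim (BruhatTits.AffineBuilding ν π n) = ((n - 1 : ℕ) : ℕ∞) := by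
  refine le_antisymm (iInf₂_le _ (BruhatTits.AffineBuilding.asdimLE hπ hn))
    (le_iInf₂ fun k hk => ?_)
  obtain ⟨m, rfl⟩ := Nat.exists_eq_succ_of_ne_zero (Nat.one_le_iff_ne_zero.1 hn)
  exact_mod_cast BruhatTits.AffineBuilding.le_of_asdimLE_succ hπ hk
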